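/- Let $\mathcal X,\mathcal Y_1,\mathcal Y_2$ be finite alphabets, let $P_{XY_1Y_2}$ and $\bar P_{XY_1Y_2}$ be two pmfs on $\mathcal X\times\mathcal Y_1\times\mathcal Y_2$, and let $R_1,R_2\ge 0$. Under hypothesis $\mathcal H=0$ (resp. $\mathcal H=1$) the triples $(X_t,Y_{1,t},Y_{2,t})$, $t=1,\dots,n$, are i.i.d. with law $P_{XY_1Y_2}$ (resp. $\bar P_{XY_1Y_2}$). A sensor sends $M_1=\phi_{1,n}(X^n)\in\{0,\dots,\mathsf W_{1,n}-1\}$ to both detectors. Detector 1 sends $M_2=\phi_{2,n}(M_1,Y_1^n)\in\{0,\dots,\mathsf W_{2,n}-1\}$ to Detector 2 and guesses $\hat{\mathcal H}_1=\psi_{1,n}(M_1,Y_1^n)\in\{0,1\}$; Detector 2 guesses $\hat{\mathcal H}_2=\psi_{2,n}(M_1,M_2,Y_2^n)\in\{0,1\}$. For $i=1,2$ put $\alpha_{i,n}=\Pr\{\hat{\mathcal H}_i=1\mid\mathcal H=0\}$ and $\beta_{i,n}=\Pr\{\hat{\mathcal H}_i=0\mid\mathcal H=1\}$ (coherent detection).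 A pair $(\theta_1,\theta_2)\in\mathbb R^2$ is achievable if there are functions $\phi_{1,n},\phi_{2,n},\psi_{1,n},\psi_{2,n}$ for all $n$ such that, for $i=1,2$, $$\limsup_{n\to\infty}\alpha_{i,n}\le 0,\qquad \theta_i\le\liminf_{n\to\infty}-\frac1n\log\beta_{i,n},\qquad \limsup_{n\to\infty}\frac1n\log\mathsf W_{i,n}\le R_i ,$$ with $-\log 0=+\infty$. Let $\mathcal E(R_1,R_2)$ be the closure of the set of achievable pairs. Let $\mathcal S(R_1,R_2)$ be the set of pairs $(U,V)$ of finite-valued random variables, jointly distributed with $(X,Y_1,Y_2)\sim P_{XY_1Y_2}$, such that $U - X - (Y_1,Y_2)$ and $V - (Y_1,U) - (Y_2,X)$ are Markov chains, $I(U;X)\le R_1$ and $I(V;Y_1|U)\le R_2$. For $(U,V)\in\mathcal S(R_1,R_2)$ let $\mathcal L_1(U)$ be the set of triples $(\tilde U,\tilde X,\tilde Y_1)$ with $P_{\tilde U\tilde X}=P_{UX}$ and $P_{\tilde U\tilde Y_1}=P_{UY_1}$; let $\mathcal L_2(UV)$ be the set of tuples $(\tilde U,\tilde V,\tilde X,\tilde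 Y_1,\tilde Y_2)$ with $P_{\tilde U\tilde X}=P_{UX}$, $P_{\tilde U\tilde V\tilde Y_1}=P_{UVY_1}$ and $P_{\tilde U\tilde V\tilde Y_2}=P_{UVY_2}$; and let $(\bar U,\bar V)$ be jointly distributed with $(\bar X,\bar Y_1,\bar Y_2)\sim\bar P_{XY_1Y_2}$ so that $P_{\bar U|\bar X}=P_{U|X}$, $P_{\bar V|\bar Y_1\bar U}=P_{V|Y_1U}$ (wherever both conditional laws are defined), and $\bar U-\bar X-(\bar Y_1,\bar Y_2)$ and $\bar V-(\bar Y_1,\bar U)-(\bar X,\bar Y_2)$ are Markov chains. Then $\mathcal E(R_1,R_2)$ contains every pair $(\theta_1,\theta_2)$ with $\theta_1,\theta_2\ge 0$ for which there is some $(U,V)\in\mathcal S(R_1,R_2)$ with $$\theta_1\le\min_{(\tilde U,\tilde X,\tilde Y_1)\in\mathcal L_1(U)}D\big(\tilde U\tilde X\tilde Y_1\,\|\,\bar U\bar X\bar Y_1\big),\qquad \theta_2\le\min_{(\tilde U,\tilde V,\tilde X,\tilde Y_1,\tilde Y_2)\in\mathcal L_2(UV)}D\big(\tilde V\tilde U\tilde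 X\tilde Y_1\tilde Y_2\,\|\,\bar V\bar U\bar X\bar Y_1\bar Y_2\big),$$ where $D$ is the Kullback-Leibler divergence, equal to $+\infty$ when absolute continuity fails. All logarithms have the same base. -/

import Mathlib

open Filter Topology
open scoped ENNReal

noncomputable section

namespace CoopHT

/-! ### Information measures on finite alphabets (natural logarithms) -/

/-- The Kullback-Leibler divergence `D(p ‖ q)` of two pmfs; it is `∞` unless `p ≪ q`. -/
def relEntropy {α : Type*} (p q : PMF α) : ℝ≥0∞ :=
  letI : MeasurableSpace α := ⊤
  InformationTheory.klDiv p.toMeasure q.toMeasure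

/-- Mutual information `I(A;B)` of the random variables `A`, `B` on the probability space `(Ω, p)`:
`∑ P_{AB}(a,b) log (P_{AB}(a,b) / (P_A(a) P_B(b)))`. -/
def mutualInfo {Ω α β : Type*} [Fintype α] [Fintype β] (p : PMF Ω) (A : Ω → α) (B : Ω → β) : ℝ :=
  ∑ a, ∑ b, (p.map (fun ω => (A ω, B ω)) (a, b)).toReal *
    Real.log ((p.map (fun ω => (A ω, B ω)) (a, b)).toReal /
      ((p.map A a).toReal * (p.map B b).toReal))

/-- Conditional mutual information `I(A;B|C)`:
`∑ P_{ABC}(a,b,c) log (P_{ABC}(a,b,c) P_C(c) / (P_{AC}(a,c) P_{BC}(b,c)))`. -/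
def condMutualInfo {Ω α β γ : Type*} [Fintype α] [Fintype β] [Fintype γ]
    (p : PMF Ω) (A : Ω → α) (B : Ω → β) (C : Ω → γ) : ℝ :=
  ∑ a, ∑ b, ∑ c, (p.map (fun ω => (A ω, B ω, C ω)) (a, b, c)).toReal *
    Real.log ((p.map (fun ω => (A ω, B ω, C ω)) (a, b, c)).toReal * (p.map C c).toReal /
      ((p.map (fun ω => (A ω, C ω)) (a, c)).toReal *
        (p.map (fun ω => (B ω, C ω)) (b, c)).toReal))

/-- The Markov chain `A - B - C`: `A` and `C` are conditionally independent given `B`. -/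
def IsMarkovChain {Ω α β γ : Type*} (p : PMF Ω) (A : Ω → α) (B : Ω → β) (C : Ω → γ) : Prop :=
  ∀ a b c, p.map (fun ω => (A ω, B ω, C ω)) (a, b, c) * p.map B b =
    p.map (fun ω => (A ω, B ω)) (a, b) * p.map (fun ω => (B ω, C ω)) (b, c)

/-- The conditional law of `A` given `B` is the same under `q` as under `p`, i.e.
`q(a|b) = p(a|b)` for every `b` that has positive probability under both laws. -/
def SameConditional {Ω α β : Type*} (p q : PMF Ω) (A : Ω → α) (B : Ω → β) : Prop :=
  ∀ a b, q.map (fun ω => (A ω, B ω)) (a, b) * p.map B b =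
    p.map (fun ω => (A ω, B ω)) (a, b) * q.map B b

/-! ### The testing problem -/

/-- A code of blocklength `n`: message set sizes, the encoder of the sensor, the encoder and the
decision function of Detector 1, and the decision function of Detector 2. -/
structure Code (X Y₁ Y₂ : Type*) (n : ℕ) where
  W₁ : ℕ
  W₂ : ℕ
  φ₁ : (Fin n → X) → Fin W₁
  φ₂ : Fin W₁ → (Fin n → Y₁) → Fin W₂
  ψ₁ : Fin W₁ → (Fin n → Y₁) → Fin 2
  ψ₂ : Fin W₁ → Fin W₂ → (Fin n → Y₂) → Fin 2

section Testing

variable {X Y₁ Y₂ : Type*} [Fintype X] [Fintype Y₁] [Fintype Y₂] {n : ℕ}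

/-- The guess of Detector 1 on the observation block `s`. -/
def Code.guess₁ (c : Code X Y₁ Y₂ n) (s : Fin n → X × Y₁ × Y₂) : Fin 2 :=
  c.ψ₁ (c.φ₁ fun t => (s t).1) (fun t => (s t).2.1)

/-- The guess of Detector 2 on the observation block `s`. -/
def Code.guess₂ (c : Code X Y₁ Y₂ n) (s : Fin n → X × Y₁ × Y₂) : Fin 2 :=
  c.ψ₂ (c.φ₁ fun t => (s t).1) (c.φ₂ (c.φ₁ fun t => (s t).1) (fun t => (s t).2.1))
    (fun t => (s t).2.2)

/-- Probability of the event `A` when the entries of the block are i.i.d. with law `p`. -/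
def iidProb {α : Type*} [Fintype α] (p : PMF α) (n : ℕ) (A : Set (Fin n → α)) : ℝ≥0∞ :=
  ∑ s : Fin n → α, A.indicator (fun s => ∏ t, p (s t)) s

/-- The law of one observation triple under hypothesis `h`. -/
def hypLaw (P Pbar : PMF (X × Y₁ × Y₂)) (h : Fin 2) : PMF (X × Y₁ × Y₂) :=
  if h = 0 then P else Pbar

/-- `Pr{Ĥ₁ = g | H = h}`. -/
def Code.prob₁ (c : Code X Y₁ Y₂ n) (P Pbar : PMF (X × Y₁ × Y₂)) (g h : Fin 2) : ℝ≥0∞ :=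
  iidProb (hypLaw P Pbar h) n {s | c.guess₁ s = g}

/-- `Pr{Ĥ₂ = g | H = h}`. -/
def Code.prob₂ (c : Code X Y₁ Y₂ n) (P Pbar : PMF (X × Y₁ × Y₂)) (g h : Fin 2) : ℝ≥0∞ :=
  iidProb (hypLaw P Pbar h) n {s | c.guess₂ s = g}

/-- `-(1/n) log β`, with value `+∞` when `β = 0`. -/
def errorExponent (n : ℕ) (β : ℝ≥0∞) : EReal :=
  -ENNReal.log β / (n : EReal)

/-- Achievability of `θ = (θ₁, θ₂)` at rates `R₁, R₂`. Detector 1 maximizes its exponent under the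
hypothesis `hbar₁`, where `hbar₁ = 1` is coherent and `hbar₁ = 0` concurrent detection; the other
hypothesis is `hbar₁ + 1`, computed modulo 2. -/
def IsAchievable (hbar₁ : Fin 2) (P Pbar : PMF (X × Y₁ × Y₂)) (R₁ R₂ : ℝ) (θ : ℝ × ℝ) : Prop :=
  ∃ c : ∀ n : ℕ, Code X Y₁ Y₂ n,
    limsup (fun n => (c n).prob₁ P Pbar hbar₁ (hbar₁ + 1)) atTop ≤ 0 ∧
    limsup (fun n => (c n).prob₂ P Pbar 1 0) atTop ≤ 0 ∧
    (θ.1 : EReal) ≤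
      liminf (fun n => errorExponent n ((c n).prob₁ P Pbar (hbar₁ + 1) hbar₁)) atTop ∧
    (θ.2 : EReal) ≤ liminf (fun n => errorExponent n ((c n).prob₂ P Pbar 0 1)) atTop ∧
    limsup (fun n : ℕ => ((Real.log ((c n).W₁ : ℝ) / (n : ℝ) : ℝ) : EReal)) atTop ≤ (R₁ : EReal) ∧
    limsup (fun n : ℕ => ((Real.log ((c n).W₂ : ℝ) / (n : ℝ) : ℝ) : EReal)) atTop ≤ (R₂ : EReal)

/-- The error-exponents region `E(R₁, R₂)`. -/
def exponentsRegion (hbar₁ : Fin 2) (P Pbar : PMF (X × Y₁ × Y₂)) (R₁ R₂ : ℝ) : Set (ℝ × ℝ) :=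
  closure {θ | IsAchievable hbar₁ P Pbar R₁ R₂ θ}

end Testing

/-! ### Auxiliary random variables

The coordinates of an outcome `(u, v, x, y₁, y₂)` are the random variables `U, V, X, Y₁, Y₂`. -/

section Auxiliary

variable {U V X Y₁ Y₂ : Type*}

/-- The coordinate `U`. -/
def cU (ω : U × V × X × Y₁ × Y₂) : U := ω.1
/-- The coordinate `V`. -/
def cV (ω : U × V × X × Y₁ × Y₂) : V := ω.2.1
/-- The coordinate `X`. -/
def cX (ω : U × V × X × Y₁ × Y₂) : X := ω.2.2.1
/-- The coordinate `Y₁`. -/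
def cY₁ (ω : U × V × X × Y₁ × Y₂) : Y₁ := ω.2.2.2.1
/-- The coordinate `Y₂`. -/
def cY₂ (ω : U × V × X × Y₁ × Y₂) : Y₂ := ω.2.2.2.2

/-- `Q` is a joint law of `(U, V, X, Y₁, Y₂)` extending the law `P` of `(X, Y₁, Y₂)` and satisfying
the Markov chains `U - X - (Y₁, Y₂)` and `V - (Y₁, U) - (Y₂, X)`. -/
def IsAuxiliaryLaw (P : PMF (X × Y₁ × Y₂)) (Q : PMF (U × V × X × Y₁ × Y₂)) : Prop :=
  Q.map (fun ω => (cX ω, cY₁ ω, cY₂ ω)) = P ∧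
  IsMarkovChain Q cU cX (fun ω => (cY₁ ω, cY₂ ω)) ∧
  IsMarkovChain Q cV (fun ω => (cY₁ ω, cU ω)) (fun ω => (cY₂ ω, cX ω))

/-- The set `S(R₁, R₂)` of auxiliary pairs `(U, V)`, each given by its joint law with
`(X, Y₁, Y₂)`. -/
def auxiliarySet [Fintype U] [Fintype V] [Fintype X] [Fintype Y₁]
    (P : PMF (X × Y₁ × Y₂)) (R₁ R₂ : ℝ) : Set (PMF (U × V × X × Y₁ × Y₂)) :=
  {Q | IsAuxiliaryLaw P Q ∧ mutualInfo Q cU cX ≤ R₁ ∧ condMutualInfo Q cV cY₁ cU ≤ R₂}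

/-- `Qbar` is a joint law of `(Ū, V̄, X̄, Ȳ₁, Ȳ₂)`: it extends `Pbar`, it has the conditional laws
`P_{U|X}` and `P_{V|Y₁U}` of `Q`, and it satisfies the same Markov chains. -/
def IsAlternativeLaw (Pbar : PMF (X × Y₁ × Y₂)) (Q Qbar : PMF (U × V × X × Y₁ × Y₂)) : Prop :=
  IsAuxiliaryLaw Pbar Qbar ∧
  SameConditional Q Qbar cU cX ∧
  SameConditional Q Qbar cV (fun ω => (cY₁ ω, cU ω))

/-- The set `L₁(U)` of joint laws of `(Ũ, X̃, Ỹ₁)`. -/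
def L₁ (Q : PMF (U × V × X × Y₁ × Y₂)) : Set (PMF (U × X × Y₁)) :=
  {q | q.map (fun ω => (ω.1, ω.2.1)) = Q.map (fun ω => (cU ω, cX ω)) ∧
    q.map (fun ω => (ω.1, ω.2.2)) = Q.map (fun ω => (cU ω, cY₁ ω))}

/-- The set `L₂(UV)` of joint laws of `(Ũ, Ṽ, X̃, Ỹ₁, Ỹ₂)`. -/
def L₂ (Q : PMF (U × V × X × Y₁ × Y₂)) : Set (PMF (U × V × X × Y₁ × Y₂)) :=
  {q | q.map (fun ω => (cU ω, cX ω)) = Q.map (fun ω => (cU ω, cX ω)) ∧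
    q.map (fun ω => (cU ω, cV ω, cY₁ ω)) = Q.map (fun ω => (cU ω, cV ω, cY₁ ω)) ∧
    q.map (fun ω => (cU ω, cV ω, cY₂ ω)) = Q.map (fun ω => (cU ω, cV ω, cY₂ ω))}

end Auxiliary

end CoopHT

end

/-!
The scheme is random coding with two layers. The sensor's codewords `u` are drawn i.i.d. from
`P_U`, about `exp (n I(U;X))` of them; to each of them belong about `exp (n I(V;Y₁|U))` codewords
`v`, drawn from `P_{V|U}`. The sensor sends the index of a `u` typical with `x`, Detector 1 that of a
`v` typical with `(u, y₁)`; Detector 1 accepts if both were found, Detector 2 if moreover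
`(u, v, y₂)` is typical.

One estimate carries both kinds of error. If `(X, Y₁, Y₂)` has law `P'` and `Q'` is the extension of
`P'` by the test channels `P_{U|X}` and `P_{V|Y₁U}`, then on typical blocks drawing `u` and `v`
independently of the source differs from drawing them through the test channels exactly by the
information densities (`pr_mul_eq_lawUS_mul_exp`, `kernelVU_mul_eq_pr_mul_exp`). Hence the union
bound over all pairs of codewords, whose number cancels this factor up to `exp (n η)`, shows that
an event concerning the chosen codewords and the sources has average probability at most
`exp (n η) * Q'ⁿ(event)` (`sum_first_layer_le`, `sum_second_layer_le`).

* With `P' = Pbar` and the acceptance regions as events, this reduces the errors of the second kind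
  to a Sanov bound for `Qbarⁿ`. The bound is obtained without counting types: each law in the compact
  set `L₁` or `L₂` is separated from `Qbar` by a test function that nearly attains its divergence
  (`exists_dual_of_le_relEntropy`), Chernoff's inequality bounds the probability of a neighbourhood,
  and finitely many neighbourhoods cover (`exists_blockProb_near_le`).
* With `P' = P` and the event that `(u, v, y₂)` is atypical, it replaces the Markov lemma, because
  atypicality has exponentially small probability under `Qⁿ` (`blockProb_not_typ_le`). What remains
  of the first kind is that a search for a codeword fails, which is the covering lemma
  `sum_mul_miss_pow_le`.

Averaging gives one codebook that is good for all error probabilities at once (`exists_codebook`),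
and a diagonal sequence of codes attains the rates and exponents exactly.
-/

set_option linter.unusedSectionVars false

noncomputable section

namespace CoopHT

/-! ### Blocks of i.i.d. letters, Chernoff bounds and typicality -/

section Blocks

open scoped Classical

variable {α β : Type*} [Fintype α] [Fintype β]

/-- The probability of the outcome `a` as a real number. -/
def pr (p : PMF α) (a : α) : ℝ := (p a).toReal

lemma pr_nonneg (p : PMF α) (a : α) : 0 ≤ pr p a := ENNReal.toReal_nonneg

lemma sum_pr (p : PMF α) : ∑ a, pr p a = 1 := by
  unfold pr
  rw [← ENNReal.toReal_sum (fun a _ => p.apply_ne_top a), ← tsum_fintype (L := .unconditional _),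
    p.tsum_coe]
  simp

lemma pr_map {γ : Type*} (p : PMF α) (g : α → γ) (b : γ) :
    pr (p.map g) b = ∑ a, if g a = b then pr p a else 0 := by
  unfold pr
  rw [PMF.map_apply, tsum_fintype, ENNReal.toReal_sum]
  · refine Finset.sum_congr rfl fun a _ => ?_
    by_cases h : g a = b
    · simp [h]
    · simp [h, Ne.symm h]
  · intro a _
    split_ifs
    · exact p.apply_ne_top a
    · simp

lemma pr_map_injective (p : PMF α) {g : α → β} (hg : Function.Injective g) (a : α) :
    pr (p.map g) (g a) = pr p a := by
  unfold pr
  rw [PMF.map_apply, tsum_eq_single a]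
  · simp
  · intro b hb
    rw [if_neg]
    exact fun h => hb (hg h.symm)

lemma pr_le_pr_map {γ : Type*} (p : PMF α) (g : α → γ) (a : α) : pr p a ≤ pr (p.map g) (g a) := by
  rw [pr_map]
  have := Finset.single_le_sum (f := fun a' => if g a' = g a then pr p a' else 0)
    (fun a' _ => by split_ifs <;> simp [pr_nonneg]) (Finset.mem_univ a)
  simpa using this

/-- The probability of the block `s` when its entries are i.i.d. with law `p`. -/
def blockPr (p : PMF α) {n : ℕ} (s : Fin n → α) : ℝ := ∏ t, pr p (s t)

lemma blockPr_nonneg (p : PMF α) {n : ℕ} (s : Fin n → α) : 0 ≤ blockPr p s :=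
  Finset.prod_nonneg fun _ _ => pr_nonneg p _

/-- Expectations of products of functions of independent entries factorize. -/
lemma sum_prod_mul_prod {ι γ : Type*} [Fintype ι] [DecidableEq ι] [Fintype γ]
    (w g : ι → γ → ℝ) :
    ∑ c : ι → γ, (∏ i, w i (c i)) * ∏ i, g i (c i) = ∏ i, ∑ a, w i a * g i a := by
  rw [Finset.prod_univ_sum, Fintype.piFinset_univ]
  simp_rw [Finset.prod_mul_distrib]

lemma sum_blockPr_mul_prod (p : PMF α) (n : ℕ) (f : α → ℝ) :
    ∑ s : Fin n → α, blockPr p s * ∏ t, f (s t) = (∑ a, pr p a * f a) ^ n := by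
  unfold blockPr
  rw [sum_prod_mul_prod (fun _ => pr p) (fun _ => f)]
  simp

lemma sum_blockPr (p : PMF α) (n : ℕ) : ∑ s : Fin n → α, blockPr p s = 1 := by
  have := sum_blockPr_mul_prod p n (fun _ => 1)
  simpa [sum_pr] using this

/-- The probability of the event `A` when the entries of the block are i.i.d. with law `p`. -/
def blockProb (p : PMF α) (n : ℕ) (A : Set (Fin n → α)) : ℝ :=
  ∑ s : Fin n → α, if s ∈ A then blockPr p s else 0

lemma blockProb_nonneg (p : PMF α) (n : ℕ) (A : Set (Fin n → α)) : 0 ≤ blockProb p n A :=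
  Finset.sum_nonneg fun s _ => by split_ifs <;> simp [blockPr_nonneg]

lemma blockProb_mono (p : PMF α) (n : ℕ) {A B : Set (Fin n → α)} (h : A ⊆ B) :
    blockProb p n A ≤ blockProb p n B :=
  Finset.sum_le_sum fun s _ => by
    by_cases hs : s ∈ A
    · simp [hs, h hs]
    · simp only [hs, if_false]; split_ifs <;> simp [blockPr_nonneg]

lemma blockProb_iUnion_le {ι : Type*} (I : Finset ι) (p : PMF α) (n : ℕ)
    (A : ι → Set (Fin n → α)) :
    blockProb p n {s | ∃ i ∈ I, s ∈ A i} ≤ ∑ i ∈ I, blockProb p n (A i) := by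
  unfold blockProb
  rw [Finset.sum_comm]
  refine Finset.sum_le_sum fun s _ => ?_
  have hnn : ∀ i ∈ I, (0 : ℝ) ≤ if s ∈ A i then blockPr p s else 0 := fun i _ => by
    split_ifs <;> simp [blockPr_nonneg]
  split_ifs with h
  · obtain ⟨i, hi, hs⟩ := h
    have := Finset.single_le_sum hnn hi
    simpa [hs] using this
  · exact Finset.sum_nonneg hnn

lemma iidProb_eq_ofReal (p : PMF α) (n : ℕ) (A : Set (Fin n → α)) :
    iidProb p n A = ENNReal.ofReal (blockProb p n A) := by
  unfold iidProb blockProb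
  rw [ENNReal.ofReal_sum_of_nonneg (fun s _ => by split_ifs <;> simp [blockPr_nonneg])]
  refine Finset.sum_congr rfl fun s _ => ?_
  rw [Set.indicator_apply]
  split_ifs
  · unfold blockPr pr
    rw [ENNReal.ofReal_prod_of_nonneg (fun _ _ => ENNReal.toReal_nonneg)]
    exact Finset.prod_congr rfl fun t _ => (ENNReal.ofReal_toReal (p.apply_ne_top _)).symm
  · simp

/-- Chernoff's bound: Markov's inequality for `exp (∑ f (s t))`. -/
lemma blockProb_chernoff (p : PMF α) (n : ℕ) (f : α → ℝ) (b : ℝ) :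
    blockProb p n {s | n * b ≤ ∑ t, f (s t)} ≤
      Real.exp (-(n * b)) * (∑ a, pr p a * Real.exp (f a)) ^ n := by
  rw [← sum_blockPr_mul_prod, Finset.mul_sum]
  refine Finset.sum_le_sum fun s _ => ?_
  rw [← Real.exp_sum, mul_left_comm, ← Real.exp_add]
  split_ifs with h
  · refine le_mul_of_one_le_right (blockPr_nonneg p s) (Real.one_le_exp ?_)
    simp only [Set.mem_ofPred_eq] at h
    linarith
  · exact mul_nonneg (blockPr_nonneg p s) (Real.exp_pos _).le

/-- The empirical law of a block. -/
def emp {n : ℕ} (s : Fin n → α) (a : α) : ℝ := (∑ t, if s t = a then 1 else 0) / n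

lemma sum_emp_mul {n : ℕ} (s : Fin n → α) (f : α → ℝ) :
    ∑ a, emp s a * f a = (∑ t, f (s t)) / n := by
  unfold emp
  simp_rw [div_mul_eq_mul_div, ← Finset.sum_div, Finset.sum_mul]
  rw [Finset.sum_comm]
  simp

lemma emp_mem_stdSimplex {n : ℕ} (hn : 0 < n) (s : Fin n → α) : emp s ∈ stdSimplex ℝ α := by
  refine ⟨fun a => by unfold emp; positivity, ?_⟩
  have := sum_emp_mul s (fun _ => 1)
  have hn' : (n : ℝ) ≠ 0 := by positivity
  simpa [hn'] using this

lemma emp_comp {n : ℕ} (s : Fin n → α) (g : α → β) (b : β) :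
    emp (fun t => g (s t)) b = ∑ a, if g a = b then emp s a else 0 := by
  have := sum_emp_mul s (fun a => if g a = b then 1 else 0)
  simp only [mul_ite, mul_one, mul_zero] at this
  rw [this]; rfl

/-- Sanov's upper bound in dual form: if every point `q` of a compact set `K` is separated from
`p` by an exponential test function with exponent larger than `θ`, then the empirical law lies in
some neighbourhood of `K` with probability at most `C exp (-n θ)`. -/
lemma exists_isOpen_blockProb_emp_le (p : PMF α) {K : Set (α → ℝ)} (hK : IsCompact K) (θ : ℝ)
    (h : ∀ q ∈ K, ∃ f : α → ℝ, Real.log (∑ a, pr p a * Real.exp (f a)) + θ < ∑ a, q a * f a) :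
    ∃ O : Set (α → ℝ), IsOpen O ∧ K ⊆ O ∧ ∃ C : ℝ, 0 < C ∧
      ∀ n : ℕ, 0 < n → blockProb p n {s | emp s ∈ O} ≤ C * Real.exp (-(n * θ)) := by
  choose! f hf using h
  let Λ : (α → ℝ) → ℝ := fun q => Real.log (∑ a, pr p a * Real.exp (f q a))
  let N : (α → ℝ) → Set (α → ℝ) := fun q => {r | Λ q + θ < ∑ a, r a * f q a}
  have hNo : ∀ q, IsOpen (N q) := fun q => isOpen_lt (by fun_prop) (by fun_prop)
  obtain ⟨F, hFK, hF⟩ := hK.elim_nhds_subcover N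
    (fun q hq => (hNo q).mem_nhds (hf q hq))
  refine ⟨⋃ q ∈ F, N q, isOpen_biUnion fun q _ => hNo q, hF, F.card + 1, by positivity, ?_⟩
  intro n hn
  have hn' : (0 : ℝ) < n := by exact_mod_cast hn
  have hN : ∀ q, blockProb p n {s | emp s ∈ N q} ≤ Real.exp (-(n * θ)) := by
    intro q
    have hpos : 0 < ∑ a, pr p a * Real.exp (f q a) := by
      obtain ⟨a, ha⟩ : ∃ a, pr p a ≠ 0 := by
        by_contra! hc
        have := sum_pr p
        simp [hc] at this
      refine Finset.sum_pos' (fun a _ => mul_nonneg (pr_nonneg p a) (Real.exp_pos _).le)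
        ⟨a, Finset.mem_univ a, mul_pos (lt_of_le_of_ne (pr_nonneg p a) ha.symm) (Real.exp_pos _)⟩
    refine (blockProb_mono p n (B := {s | n * (Λ q + θ) ≤ ∑ t, f q (s t)}) ?_).trans
      ((blockProb_chernoff p n (f q) (Λ q + θ)).trans (le_of_eq ?_))
    · intro s hs
      simp only [N, Set.mem_ofPred_eq, sum_emp_mul, lt_div_iff₀ hn'] at hs ⊢
      linarith
    · have : (∑ a, pr p a * Real.exp (f q a)) ^ n = Real.exp (n * Λ q) := by
        rw [Real.exp_nat_mul, Real.exp_log hpos]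
      rw [this, ← Real.exp_add]
      congr 1; ring
  calc blockProb p n {s | emp s ∈ ⋃ q ∈ F, N q}
      ≤ blockProb p n {s | ∃ q ∈ F, s ∈ {s | emp s ∈ N q}} :=
        blockProb_mono p n fun s hs => by simpa using hs
    _ ≤ ∑ q ∈ F, blockProb p n {s | emp s ∈ N q} := blockProb_iUnion_le F p n _
    _ ≤ ∑ q ∈ F, Real.exp (-(n * θ)) := Finset.sum_le_sum fun q _ => hN q
    _ ≤ (F.card + 1) * Real.exp (-(n * θ)) := by
        rw [Finset.sum_const, nsmul_eq_mul]
        have := Real.exp_pos (-(n * θ))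
        nlinarith

/-- Strong typicality: all relative frequencies are within `δ` of the probabilities, and
symbols of probability zero do not occur. -/
def Typ (p : PMF α) (δ : ℝ) {n : ℕ} (s : Fin n → α) : Prop :=
  (∀ a, |emp s a - pr p a| ≤ δ) ∧ ∀ t, pr p (s t) ≠ 0

lemma Typ.abs_sum_sub_le {p : PMF α} {δ : ℝ} {n : ℕ} {s : Fin n → α} (h : Typ p δ s)
    (f : α → ℝ) : |∑ t, f (s t) - n * ∑ a, pr p a * f a| ≤ n * (δ * ∑ a, |f a|) := by
  rcases Nat.eq_zero_or_pos n with rfl | hn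
  · simp
  have hn' : (0 : ℝ) < n := by exact_mod_cast hn
  have h1 : ∑ t, f (s t) = n * ∑ a, emp s a * f a := by
    rw [sum_emp_mul]; field_simp
  rw [h1, ← mul_sub, abs_mul, abs_of_pos hn', ← Finset.sum_sub_distrib]
  refine mul_le_mul_of_nonneg_left ?_ hn'.le
  refine (Finset.abs_sum_le_sum_abs _ _).trans ?_
  rw [Finset.mul_sum]
  refine Finset.sum_le_sum fun a _ => ?_
  rw [← sub_mul, abs_mul]
  exact mul_le_mul_of_nonneg_right (h.1 a) (abs_nonneg _)

/-- One-sided deviations of relative frequencies (`σ = ±1` is the side). -/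
lemma blockProb_deviation_le (p : PMF α) (n : ℕ) (g : α → β) (b : β) {δ : ℝ} (hδ : 0 < δ)
    (hδ1 : δ ≤ 1) {σ : ℝ} (hσ : |σ| = 1) :
    blockProb p n {s | n * δ ≤ ∑ t, σ * ((if g (s t) = b then 1 else 0) - pr (p.map g) b)} ≤
      Real.exp (-(n * (δ ^ 2 / 4))) := by
  set π := pr (p.map g) b with hπ
  have hπ0 : 0 ≤ π := pr_nonneg _ _
  have hπ1 : π ≤ 1 := by
    have := Finset.single_le_sum (fun b _ => pr_nonneg (p.map g) b) (Finset.mem_univ b)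
    rwa [sum_pr] at this
  have hσ2 : σ ^ 2 = 1 := by rw [← sq_abs, hσ, one_pow]
  have key := blockProb_chernoff p n
    (fun a => δ / 2 * (σ * ((if g a = b then 1 else 0) - π))) (δ / 2 * δ)
  have hset : {s : Fin n → α | n * δ ≤ ∑ t, σ * ((if g (s t) = b then 1 else 0) - π)} =
      {s | n * (δ / 2 * δ) ≤ ∑ t, δ / 2 * (σ * ((if g (s t) = b then 1 else 0) - π))} := by
    ext s
    simp only [Set.mem_ofPred_eq, ← Finset.mul_sum]
    constructor <;> intro h <;> nlinarith
  rw [hset]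
  refine key.trans ?_
  -- the moment generating function at `δ / 2`
  have hmgf : ∑ a, pr p a * Real.exp (δ / 2 * (σ * ((if g a = b then 1 else 0) - π))) ≤
      Real.exp (δ ^ 2 / 4) := by
    have hsplit : ∀ a, pr p a * Real.exp (δ / 2 * (σ * ((if g a = b then 1 else 0) - π))) =
        Real.exp (-(δ / 2 * σ * π)) *
          (pr p a + (if g a = b then pr p a else 0) * (Real.exp (δ / 2 * σ) - 1)) := by
      intro a
      split_ifs
      · rw [show δ / 2 * (σ * (1 - π)) = -(δ / 2 * σ * π) + δ / 2 * σ by ring, Real.exp_add]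
        ring
      · rw [show δ / 2 * (σ * (0 - π)) = -(δ / 2 * σ * π) by ring]
        ring
    simp_rw [hsplit]
    rw [← Finset.mul_sum, Finset.sum_add_distrib, ← Finset.sum_mul, sum_pr, ← pr_map, ← hπ]
    have habs : |δ / 2 * σ| ≤ 1 := by
      rw [abs_mul, hσ, abs_of_pos (by positivity)]; linarith
    have hexp := (abs_le.mp (Real.abs_exp_sub_one_sub_id_le habs)).2
    have hle : 1 + π * (Real.exp (δ / 2 * σ) - 1) ≤
        Real.exp (δ / 2 * σ * π + δ ^ 2 / 4) := by
      refine le_trans ?_ (Real.add_one_le_exp _)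
      have h2 : (δ / 2 * σ) ^ 2 = δ ^ 2 / 4 := by rw [mul_pow, hσ2]; ring
      rw [h2] at hexp
      nlinarith [mul_le_mul_of_nonneg_left hexp hπ0, sq_nonneg δ]
    calc _ ≤ Real.exp (-(δ / 2 * σ * π)) * Real.exp (δ / 2 * σ * π + δ ^ 2 / 4) :=
          mul_le_mul_of_nonneg_left hle (Real.exp_pos _).le
      _ = _ := by rw [← Real.exp_add]; congr 1; ring
  calc _ ≤ Real.exp (-(n * (δ / 2 * δ))) * Real.exp (δ ^ 2 / 4) ^ n := by
        refine mul_le_mul_of_nonneg_left (pow_le_pow_left₀ ?_ hmgf n) (Real.exp_pos _).le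
        exact Finset.sum_nonneg fun a _ => mul_nonneg (pr_nonneg p a) (Real.exp_pos _).le
    _ = _ := by rw [← Real.exp_nat_mul, ← Real.exp_add]; congr 1; ring

lemma blockPr_eq_zero_of_pr_map {p : PMF α} {n : ℕ} {g : α → β} {s : Fin n → α} {t : Fin n}
    (h : pr (p.map g) (g (s t)) = 0) : blockPr p s = 0 :=
  Finset.prod_eq_zero (Finset.mem_univ t)
    (le_antisymm ((pr_le_pr_map p g _).trans h.le) (pr_nonneg _ _))

/-- A block of functions of i.i.d. entries is typical up to an exponentially small
probability. -/
lemma blockProb_not_typ_le (p : PMF α) (g : α → β) {δ : ℝ} (hδ : 0 < δ) (hδ1 : δ ≤ 1) :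
    ∀ n : ℕ, 0 < n → blockProb p n {s | ¬ Typ (p.map g) δ (fun t => g (s t))} ≤
      (2 * Fintype.card β) * Real.exp (-(n * (δ ^ 2 / 4))) := by
  intro n hn
  have hn' : (0 : ℝ) < n := by exact_mod_cast hn
  let σ : Bool → ℝ := fun i => if i then 1 else -1
  let A : β × Bool → Set (Fin n → α) := fun k =>
    {s | n * δ ≤ ∑ t, σ k.2 * ((if g (s t) = k.1 then 1 else 0) - pr (p.map g) k.1)}
  calc blockProb p n {s | ¬ Typ (p.map g) δ (fun t => g (s t))}
      ≤ blockProb p n {s | ∃ k ∈ (Finset.univ : Finset (β × Bool)), s ∈ A k} := by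
        refine Finset.sum_le_sum fun s _ => ?_
        by_cases hz : ∃ t, pr (p.map g) (g (s t)) = 0
        · obtain ⟨t, ht⟩ := hz
          simp [blockPr_eq_zero_of_pr_map ht]
        push Not at hz
        by_cases hs : Typ (p.map g) δ (fun t => g (s t))
        · simp only [Set.mem_ofPred_eq, hs, not_true_eq_false, if_false]
          split_ifs <;> simp [blockPr_nonneg]
        · suffices hmem : s ∈ {s | ∃ k ∈ (Finset.univ : Finset (β × Bool)), s ∈ A k} by
            rw [if_pos hmem]
            split_ifs <;> simp [blockPr_nonneg]
          simp only [Typ, not_and_or, not_forall] at hs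
          rcases hs with ⟨b, hb⟩ | ⟨t, ht⟩
          swap
          · exact absurd (hz t) ht
          push Not at hb
          have hsum : ∑ t, ((if g (s t) = b then (1 : ℝ) else 0) - pr (p.map g) b) =
              n * (emp (fun t => g (s t)) b - pr (p.map g) b) := by
            simp only [emp, Finset.sum_sub_distrib, Finset.sum_const, Finset.card_univ,
              Fintype.card_fin, nsmul_eq_mul]
            field_simp
          rcases lt_abs.mp hb with hb | hb
          · refine ⟨(b, true), Finset.mem_univ _, ?_⟩
            simp only [A, σ, Set.mem_ofPred_eq, if_true, one_mul]
            rw [hsum]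
            exact mul_le_mul_of_nonneg_left hb.le hn'.le
          · refine ⟨(b, false), Finset.mem_univ _, ?_⟩
            simp only [A, σ, Set.mem_ofPred_eq, ← Finset.mul_sum]
            rw [hsum]
            have := mul_le_mul_of_nonneg_left hb.le hn'.le
            simp only [Bool.false_eq_true, if_false]
            linarith
    _ ≤ ∑ k : β × Bool, blockProb p n (A k) := blockProb_iUnion_le _ p n A
    _ ≤ ∑ k : β × Bool, Real.exp (-(n * (δ ^ 2 / 4))) :=
        Finset.sum_le_sum fun k _ => blockProb_deviation_le p n g k.1 hδ hδ1
          (by cases k.2 <;> simp [σ])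
    _ = (2 * Fintype.card β) * Real.exp (-(n * (δ ^ 2 / 4))) := by
        simp [Finset.sum_const, mul_comm]

end Blocks

/-! ### Divergence, duality and Sanov's bound -/

section Divergence

open scoped Classical

variable {α : Type*} [Fintype α]

/-- The pointwise inequality behind the nonnegativity of divergences. -/
lemma sub_le_mul_log_div {p q : ℝ} (hp : 0 ≤ p) (hq : 0 ≤ q) (h : q = 0 → p = 0) :
    p - q ≤ p * Real.log (p / q) := by
  rcases hp.eq_or_lt with rfl | hp
  · simpa using hq
  have hq' : 0 < q := lt_of_le_of_ne hq fun hc => hp.ne' (h hc.symm)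
  have := Real.one_sub_inv_le_log_of_pos (x := p / q) (by positivity)
  rw [inv_div] at this
  have := mul_le_mul_of_nonneg_left this hp.le
  rwa [mul_sub, mul_one, mul_div_cancel₀ _ hp.ne'] at this

/-- Absolutely continuous case: the divergence is the expected log-likelihood ratio. -/
lemma relEntropy_eq_of_forall (p q : PMF α) (h : ∀ a, pr q a = 0 → pr p a = 0) :
    relEntropy p q = ENNReal.ofReal (∑ a, pr p a * Real.log (pr p a / pr q a)) := by
  unfold relEntropy
  let _ : MeasurableSpace α := ⊤
  have : MeasurableSingletonClass α := ⟨fun _ => trivial⟩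
  have h0 : ∀ a, q a = 0 → p a = 0 := by
    intro a ha
    have := h a (by simp [pr, ha])
    simpa [pr, ENNReal.toReal_eq_zero_iff, p.apply_ne_top a] using this
  have hw : p.toMeasure = q.toMeasure.withDensity (fun a => p a / q a) := by
    refine MeasureTheory.Measure.ext_of_singleton fun a => ?_
    rw [MeasureTheory.withDensity_apply _ (MeasurableSet.singleton a),
      MeasureTheory.lintegral_singleton,
      PMF.toMeasure_apply_singleton _ _ (MeasurableSet.singleton a),
      PMF.toMeasure_apply_singleton _ _ (MeasurableSet.singleton a)]
    by_cases hq : q a = 0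
    · simp [hq, h0 a hq]
    · rw [ENNReal.div_mul_cancel hq (q.apply_ne_top a)]
  have hac : MeasureTheory.Measure.AbsolutelyContinuous p.toMeasure q.toMeasure := by
    rw [hw]; exact MeasureTheory.withDensity_absolutelyContinuous _ _
  have hrn : p.toMeasure.rnDeriv q.toMeasure =ᵐ[p.toMeasure] fun a => p a / q a := by
    have := MeasureTheory.Measure.rnDeriv_withDensity q.toMeasure
      (measurable_of_finite fun a => p a / q a)
    rw [← hw] at this
    exact hac.ae_le this
  have hint : MeasureTheory.Integrable (MeasureTheory.llr p.toMeasure q.toMeasure) p.toMeasure :=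
    MeasureTheory.Integrable.of_finite
  rw [← ENNReal.ofReal_toReal (InformationTheory.klDiv_ne_top hac hint),
    InformationTheory.toReal_klDiv_of_measure_eq hac (by simp)]
  congr 1
  have hllr : MeasureTheory.llr p.toMeasure q.toMeasure =ᵐ[p.toMeasure]
      fun a => Real.log (pr p a / pr q a) := by
    filter_upwards [hrn] with a ha
    simp [MeasureTheory.llr, ha, pr, ENNReal.toReal_div]
  rw [MeasureTheory.integral_congr_ae hllr, PMF.integral_eq_sum]
  rfl

/-- Donsker-Varadhan duality, in the direction needed for Chernoff bounds: a lower bound on the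
divergence is witnessed, up to `ε`, by a test function. -/
lemma exists_dual_of_le_relEntropy (p q : PMF α) {θ ε : ℝ} (hε : 0 < ε)
    (h : ENNReal.ofReal θ ≤ relEntropy p q) :
    ∃ f : α → ℝ, Real.log (∑ a, pr q a * Real.exp (f a)) + (θ - ε) < ∑ a, pr p a * f a := by
  by_cases hac : ∀ a, pr q a = 0 → pr p a = 0
  · rw [relEntropy_eq_of_forall p q hac] at h
    -- off the support of `p` the optimal test function is `-∞`; the constant `log (ε / 2)` will do
    obtain ⟨B, hB⟩ : ∃ B : ℝ, Real.exp B = ε / 2 :=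
      ⟨Real.log (ε / 2), Real.exp_log (by positivity)⟩
    let f : α → ℝ := fun a => if pr p a = 0 then B else Real.log (pr p a / pr q a)
    refine ⟨f, ?_⟩
    have h1 : ∑ a, pr p a * f a = ∑ a, pr p a * Real.log (pr p a / pr q a) :=
      Finset.sum_congr rfl fun a _ => by
        by_cases ha : pr p a = 0 <;> simp [f, ha]
    have h2 : ∑ a, pr q a * Real.exp (f a) ≤ 1 + ε / 2 := by
      have : ∀ a, pr q a * Real.exp (f a) ≤ pr p a + pr q a * (ε / 2) := by
        intro a
        by_cases ha : pr p a = 0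
        · simp [f, ha, hB]
        · have hq : 0 < pr q a := lt_of_le_of_ne (pr_nonneg q a) fun hc => ha (hac a hc.symm)
          have hp : 0 < pr p a := lt_of_le_of_ne (pr_nonneg p a) (Ne.symm ha)
          simp only [f, ha, if_false]
          rw [Real.exp_log (by positivity), mul_div_cancel₀ _ hq.ne']
          have : 0 ≤ pr q a * (ε / 2) := by positivity
          linarith
      refine (Finset.sum_le_sum fun a _ => this a).trans ?_
      rw [Finset.sum_add_distrib, ← Finset.sum_mul, sum_pr, sum_pr, one_mul]
    have h3 : Real.log (∑ a, pr q a * Real.exp (f a)) ≤ ε / 2 := by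
      have h0 : 0 ≤ ∑ a, pr q a * Real.exp (f a) :=
        Finset.sum_nonneg fun a _ => mul_nonneg (pr_nonneg q a) (Real.exp_pos _).le
      have := Real.log_le_sub_one_of_pos (x := 1 + ε / 2) (by positivity)
      rcases h0.eq_or_lt with h0 | h0
      · rw [← h0, Real.log_zero]; positivity
      · exact (Real.log_le_log h0 h2).trans (by linarith)
    have h4 : 0 ≤ ∑ a, pr p a * Real.log (pr p a / pr q a) := by
      have : ∀ a, pr p a - pr q a ≤ pr p a * Real.log (pr p a / pr q a) := fun a =>
        sub_le_mul_log_div (pr_nonneg p a) (pr_nonneg q a) (hac a)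
      have := Finset.sum_le_sum fun a (_ : a ∈ Finset.univ) => this a
      rw [Finset.sum_sub_distrib, sum_pr, sum_pr, sub_self] at this
      exact this
    rw [ENNReal.ofReal_le_ofReal_iff h4] at h
    rw [h1]
    linarith
  · -- a letter that only `p` charges can be given any weight at no cost under `q`
    push Not at hac
    obtain ⟨a, hqa, hpa⟩ := hac
    have hp : 0 < pr p a := lt_of_le_of_ne (pr_nonneg p a) (Ne.symm hpa)
    refine ⟨fun b => if b = a then θ / pr p a else 0, ?_⟩
    have h1 : ∑ b, pr q b * Real.exp (if b = a then θ / pr p a else 0) = 1 := by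
      rw [← sum_pr q]
      refine Finset.sum_congr rfl fun b _ => ?_
      by_cases hb : b = a
      · simp [hb, hqa]
      · simp [hb]
    rw [h1, Real.log_one]
    simp only [mul_ite, mul_zero, Finset.sum_ite_eq', Finset.mem_univ, if_true]
    rw [mul_div_cancel₀ _ hp.ne']
    linarith

/-- A probability vector as a `PMF`. -/
def pmfOfVec (q : α → ℝ) (hq : q ∈ stdSimplex ℝ α) : PMF α :=
  PMF.ofFintype (fun a => ENNReal.ofReal (q a)) (by
    rw [← ENNReal.ofReal_sum_of_nonneg (fun a _ => hq.1 a), hq.2, ENNReal.ofReal_one])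

lemma pr_pmfOfVec (q : α → ℝ) (hq : q ∈ stdSimplex ℝ α) (a : α) : pr (pmfOfVec q hq) a = q a := by
  simp [pr, pmfOfVec, ENNReal.toReal_ofReal (hq.1 a)]

lemma pmf_ext_of_pr {p q : PMF α} (h : ∀ a, pr p a = pr q a) : p = q := by
  ext a
  exact (ENNReal.toReal_eq_toReal_iff' (p.apply_ne_top a) (q.apply_ne_top a)).mp (h a)

/-- The error exponent of a test that accepts when finitely many continuous statistics
`L i` of the empirical law (below, its marginals) are close to prescribed values is at least the smallest
divergence over the laws with exactly those values. -/
lemma exists_blockProb_near_le {ι : Type*} [Fintype ι] (p : PMF α)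
    (L : ι → (α → ℝ) → ℝ) (hL : ∀ i, Continuous (L i)) (m : ι → ℝ) {θ ε : ℝ} (hε : 0 < ε)
    (h : ∀ q : PMF α, (∀ i, L i (pr q) = m i) → ENNReal.ofReal θ ≤ relEntropy q p) :
    ∃ δ : ℝ, 0 < δ ∧ ∃ C : ℝ, 0 < C ∧ ∀ n : ℕ, 0 < n →
      blockProb p n {s | ∀ i, |L i (emp s) - m i| ≤ δ} ≤ C * Real.exp (-(n * (θ - ε))) := by
  have hclosed : IsClosed {q : α → ℝ | ∀ i, L i q = m i} := by
    have : {q : α → ℝ | ∀ i, L i q = m i} = ⋂ i, {q | L i q = m i} := by ext; simp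
    rw [this]
    exact isClosed_iInter fun i => isClosed_eq (hL i) continuous_const
  have hsimplex : IsCompact (stdSimplex ℝ α) := isCompact_stdSimplex ℝ α
  obtain ⟨O, hO, hKO, C, hC, hbound⟩ := exists_isOpen_blockProb_emp_le p
    (hsimplex.inter_right hclosed) (θ - ε) (by
      rintro q ⟨hq, hqm⟩
      have hpr : pr (pmfOfVec q hq) = q := funext (pr_pmfOfVec q hq)
      have := exists_dual_of_le_relEntropy (pmfOfVec q hq) p hε
        (h _ (fun i => by rw [hpr]; exact hqm i))
      rwa [hpr] at this)
  -- outside the neighbourhood `O` the constraints are violated by a fixed amount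
  obtain ⟨δ, hδ, hδO⟩ : ∃ δ : ℝ, 0 < δ ∧ ∀ q ∈ stdSimplex ℝ α,
      (∀ i, |L i q - m i| ≤ δ) → q ∈ O := by
    have hcomp : IsCompact (stdSimplex ℝ α \ O) := hsimplex.diff hO
    rcases (stdSimplex ℝ α \ O).eq_empty_or_nonempty with he | hne
    · exact ⟨1, one_pos, fun q hq _ => by
        by_contra hqO
        exact (he ▸ ⟨hq, hqO⟩ : q ∈ (∅ : Set (α → ℝ)))⟩
    · have hcont : Continuous fun q => ∑ i, |L i q - m i| :=
        continuous_finsetSum _ fun i _ => ((hL i).sub continuous_const).abs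
      obtain ⟨q₀, hq₀, hmin⟩ := hcomp.exists_isMinOn hne hcont.continuousOn
      have hpos : 0 < ∑ i, |L i q₀ - m i| := by
        refine lt_of_le_of_ne (Finset.sum_nonneg fun _ _ => abs_nonneg _) fun h0 => hq₀.2 ?_
        refine hKO ⟨hq₀.1, fun i => ?_⟩
        have := (Finset.sum_eq_zero_iff_of_nonneg fun _ _ => abs_nonneg _).mp h0.symm i
          (Finset.mem_univ i)
        exact sub_eq_zero.mp (abs_eq_zero.mp this)
      refine ⟨(∑ i, |L i q₀ - m i|) / (Fintype.card ι + 1), by positivity, fun q hq hqi => ?_⟩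
      by_contra hqO
      have h1 := hmin (show q ∈ stdSimplex ℝ α \ O from ⟨hq, hqO⟩)
      simp only [Set.mem_ofPred_eq] at h1
      have h2 := Finset.sum_le_sum fun i (_ : i ∈ Finset.univ) => hqi i
      rw [Finset.sum_const, Finset.card_univ, nsmul_eq_mul] at h2
      have h3 : (Fintype.card ι : ℝ) * ((∑ i, |L i q₀ - m i|) / (Fintype.card ι + 1)) <
          ∑ i, |L i q₀ - m i| := by
        rw [mul_div_assoc', div_lt_iff₀ (by positivity)]
        nlinarith
      linarith
  exact ⟨δ, hδ, C, hC, fun n hn => (blockProb_mono p n fun s hs =>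
    hδO _ (emp_mem_stdSimplex hn s) hs).trans (hbound n hn)⟩

end Divergence

/-! ### Two-layer random codebooks -/

section RandomCoding

open scoped Classical

/-- The indicator of a proposition, as a real number. -/
def ind (P : Prop) : ℝ := if P then 1 else 0

lemma ind_nonneg (P : Prop) : 0 ≤ ind P := by unfold ind; split_ifs <;> simp

lemma ind_of {P : Prop} (h : P) : ind P = 1 := if_pos h

lemma ind_of_not {P : Prop} (h : ¬ P) : ind P = 0 := if_neg h

lemma ind_mono {P Q : Prop} (h : P → Q) : ind P ≤ ind Q := by
  by_cases hP : P
  · rw [ind_of hP, ind_of (h hP)]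
  · rw [ind_of_not hP]; exact ind_nonneg Q

lemma ind_or_le (P Q : Prop) : ind (P ∨ Q) ≤ ind P + ind Q := by
  unfold ind; by_cases hP : P <;> by_cases hQ : Q <;> simp [hP, hQ]

lemma ind_and (P Q : Prop) : ind (P ∧ Q) = ind P * ind Q := by
  unfold ind; by_cases hP : P <;> by_cases hQ : Q <;> simp [hP, hQ]

lemma ind_not (P : Prop) : ind (¬ P) = 1 - ind P := by
  unfold ind; by_cases hP : P <;> simp [hP]

lemma ind_forall {ι : Type*} [Fintype ι] (P : ι → Prop) : ind (∀ i, P i) = ∏ i, ind (P i) := by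
  by_cases h : ∀ i, P i
  · rw [ind_of h, Finset.prod_eq_one fun i _ => ind_of (h i)]
  · rw [ind_of_not h]
    push Not at h
    obtain ⟨i, hi⟩ := h
    exact (Finset.prod_eq_zero (Finset.mem_univ i) (ind_of_not hi)).symm

lemma ind_exists_le {ι : Type*} [Fintype ι] (P : ι → Prop) : ind (∃ i, P i) ≤ ∑ i, ind (P i) := by
  by_cases h : ∃ i, P i
  · obtain ⟨i, hi⟩ := h
    have := Finset.single_le_sum (f := fun i => ind (P i)) (fun i _ => ind_nonneg _)
      (Finset.mem_univ i)
    rw [ind_of ⟨i, hi⟩]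
    simpa [ind_of hi] using this
  · rw [ind_of_not h]
    exact Finset.sum_nonneg fun i _ => ind_nonneg _

/-- The probability of the family `c` when its members are independent with laws `w i`. -/
def prodWt {ι γ : Type*} [Fintype ι] (w : ι → γ → ℝ) (c : ι → γ) : ℝ := ∏ i, w i (c i)

lemma sum_prodWt_mul_apply {ι γ : Type*} [Fintype ι] [DecidableEq ι] [Fintype γ] {w : ι → γ → ℝ}
    (hw : ∀ i, ∑ a, w i a = 1) (i₀ : ι) (g : γ → ℝ) :
    ∑ c, prodWt w c * g (c i₀) = ∑ a, w i₀ a * g a := by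
  have := sum_prod_mul_prod w (fun i a => if i = i₀ then g a else 1)
  rw [Finset.prod_eq_single i₀] at this
  · simp only [if_true] at this
    rw [← this]
    refine Finset.sum_congr rfl fun c _ => ?_
    simp [prodWt]
  · intro i _ hi
    simp [hi, hw i]
  · simp

lemma sum_prodWt {ι γ : Type*} [Fintype ι] [DecidableEq ι] [Fintype γ] {w : ι → γ → ℝ}
    (hw : ∀ i, ∑ a, w i a = 1) : ∑ c, prodWt w c = 1 := by
  have := sum_prod_mul_prod w (fun _ _ => 1)
  simpa [hw, prodWt] using this

variable {𝒰 𝒱 𝒮 : Type*} [Fintype 𝒰] [Fintype 𝒱] [Fintype 𝒮] {M₁ M₂ : ℕ}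

/-- The probability of the two-layer codebook `(c, e)`: the first-layer words `c i` are i.i.d. with
law `a`, and independently, for each first-layer word `u`, the second-layer words `e (j, u)` are
i.i.d. with law `b u`. -/
def codebookWt (a : 𝒰 → ℝ) (b : 𝒰 → 𝒱 → ℝ)
    (ce : (Fin M₁ → 𝒰) × (Fin M₂ × 𝒰 → 𝒱)) : ℝ :=
  prodWt (fun _ => a) ce.1 * prodWt (fun k : Fin M₂ × 𝒰 => b k.2) ce.2

variable {a : 𝒰 → ℝ} {b : 𝒰 → 𝒱 → ℝ}

lemma codebookWt_nonneg (ha : ∀ u, 0 ≤ a u) (hb : ∀ u v, 0 ≤ b u v)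
    (ce : (Fin M₁ → 𝒰) × (Fin M₂ × 𝒰 → 𝒱)) : 0 ≤ codebookWt a b ce :=
  mul_nonneg (Finset.prod_nonneg fun _ _ => ha _) (Finset.prod_nonneg fun _ _ => hb _ _)

lemma sum_codebookWt (ha : ∑ u, a u = 1) (hb : ∀ u, ∑ v, b u v = 1) :
    ∑ ce : (Fin M₁ → 𝒰) × (Fin M₂ × 𝒰 → 𝒱), codebookWt a b ce = 1 := by
  rw [Fintype.sum_prod_type]
  simp only [codebookWt, ← Finset.mul_sum]
  rw [sum_prodWt (w := fun k : Fin M₂ × 𝒰 => b k.2) (fun k => hb k.2)]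
  simp [sum_prodWt (w := fun _ : Fin M₁ => a) (fun _ => ha)]

lemma sum_codebookWt_mul_fst (hb : ∀ u, ∑ v, b u v = 1) (G : (Fin M₁ → 𝒰) → ℝ) :
    ∑ ce : (Fin M₁ → 𝒰) × (Fin M₂ × 𝒰 → 𝒱), codebookWt a b ce * G ce.1 =
      ∑ c : Fin M₁ → 𝒰, prodWt (fun _ => a) c * G c := by
  rw [Fintype.sum_prod_type]
  refine Finset.sum_congr rfl fun c _ => ?_
  simp only [codebookWt]
  rw [← Finset.sum_mul, ← Finset.mul_sum,
    sum_prodWt (w := fun k : Fin M₂ × 𝒰 => b k.2) (fun k => hb k.2), mul_one]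

/-- With `g` an indicator, the probability that all first-layer words have a property. -/
lemma sum_codebookWt_mul_forall (hb : ∀ u, ∑ v, b u v = 1) (g : 𝒰 → ℝ) :
    ∑ ce : (Fin M₁ → 𝒰) × (Fin M₂ × 𝒰 → 𝒱), codebookWt a b ce * ∏ i, g (ce.1 i) =
      (∑ u, a u * g u) ^ M₁ := by
  rw [sum_codebookWt_mul_fst hb (fun c => ∏ i, g (c i))]
  have := sum_prod_mul_prod (fun _ : Fin M₁ => a) (fun _ => g)
  simpa [prodWt] using this

lemma sum_codebookWt_mul_single (ha : ∑ u, a u = 1) (hb : ∀ u, ∑ v, b u v = 1) (i : Fin M₁)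
    (g : 𝒰 → ℝ) :
    ∑ ce : (Fin M₁ → 𝒰) × (Fin M₂ × 𝒰 → 𝒱), codebookWt a b ce * g (ce.1 i) =
      ∑ u, a u * g u := by
  rw [sum_codebookWt_mul_fst hb (fun c => g (c i)),
    sum_prodWt_mul_apply (w := fun _ : Fin M₁ => a) (fun _ => ha) i g]

lemma sum_codebookWt_mul_pair (ha : ∑ u, a u = 1) (hb : ∀ u, ∑ v, b u v = 1) (i : Fin M₁)
    (j : Fin M₂) (g : 𝒰 → 𝒱 → ℝ) :
    ∑ ce : (Fin M₁ → 𝒰) × (Fin M₂ × 𝒰 → 𝒱), codebookWt a b ce * g (ce.1 i) (ce.2 (j, ce.1 i)) =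
      ∑ u, a u * ∑ v, b u v * g u v := by
  rw [Fintype.sum_prod_type]
  simp only [codebookWt, mul_assoc, ← Finset.mul_sum]
  rw [← sum_prodWt_mul_apply (w := fun _ : Fin M₁ => a) (fun _ => ha) i
    (fun u => ∑ v, b u v * g u v)]
  refine Finset.sum_congr rfl fun c _ => ?_
  rw [sum_prodWt_mul_apply (w := fun k : Fin M₂ × 𝒰 => b k.2) (fun k => hb k.2) (j, c i) (g (c i))]

/-- With `h` and `g` indicators, the probability that the `i`-th first-layer word has one property
and all second-layer words attached to it have another. -/
lemma sum_codebookWt_mul_miss (ha : ∑ u, a u = 1) (hb : ∀ u, ∑ v, b u v = 1) (i : Fin M₁)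
    (h : 𝒰 → ℝ) (g : 𝒰 → 𝒱 → ℝ) :
    ∑ ce : (Fin M₁ → 𝒰) × (Fin M₂ × 𝒰 → 𝒱),
        codebookWt a b ce * (h (ce.1 i) * ∏ j, g (ce.1 i) (ce.2 (j, ce.1 i))) =
      ∑ u, a u * (h u * (∑ v, b u v * g u v) ^ M₂) := by
  have key : ∀ u, ∑ e : Fin M₂ × 𝒰 → 𝒱, prodWt (fun k : Fin M₂ × 𝒰 => b k.2) e *
      ∏ j, g u (e (j, u)) = (∑ v, b u v * g u v) ^ M₂ := by
    intro u
    have := sum_prod_mul_prod (fun k : Fin M₂ × 𝒰 => b k.2)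
      (fun k v => if k.2 = u then g u v else 1)
    have h2 : ∏ k : Fin M₂ × 𝒰, ∑ v, b k.2 v * (if k.2 = u then g u v else 1) =
        (∑ v, b u v * g u v) ^ M₂ := by
      rw [Fintype.prod_prod_type, Finset.prod_congr rfl fun j _ =>
        Finset.prod_eq_single (M := ℝ) u (fun u' _ hu' => by simp [hu', hb u']) (by simp)]
      simp
    rw [h2] at this
    rw [← this]
    refine Finset.sum_congr rfl fun e _ => ?_
    simp [prodWt, Fintype.prod_prod_type]
  rw [Fintype.sum_prod_type]
  simp only [codebookWt, mul_assoc, ← Finset.mul_sum]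
  rw [← sum_prodWt_mul_apply (w := fun _ : Fin M₁ => a) (fun _ => ha) i
    (fun u => h u * (∑ v, b u v * g u v) ^ M₂)]
  refine Finset.sum_congr rfl fun c _ => ?_
  congr 1
  rw [← key (c i), Finset.mul_sum]
  refine Finset.sum_congr rfl fun e _ => ?_
  ring

/-- Existence of a good two-layer codebook by averaging: the error events of the code are covered
by the events that no first-layer word fits, that some fitting first-layer word has no fitting
second-layer word, and that some fitting pair of words fails the final test; each is averaged by
independence or by the union bound over the words. -/
lemma exists_codebook (ha0 : ∀ u, 0 ≤ a u) (ha : ∑ u, a u = 1) (hb0 : ∀ u v, 0 ≤ b u v)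
    (hb : ∀ u, ∑ v, b u v = 1) {p p' : 𝒮 → ℝ} (hp : ∀ s, 0 ≤ p s) (hp' : ∀ s, 0 ≤ p' s)
    (M₁ M₂ : ℕ) (T₁ B₁ : 𝒰 → 𝒮 → Prop) (T₂ T₃ : 𝒰 → 𝒱 → 𝒮 → Prop) {l₀ l₁ l₂ : ℝ}
    (hl₀ : 0 ≤ l₀) (hl₁ : 0 ≤ l₁) (hl₂ : 0 ≤ l₂)
    (hlt : l₀ * (∑ s, p s * (∑ u, a u * ind (¬ T₁ u s)) ^ M₁ +
          M₁ * ∑ s, p s * ∑ u, a u * (ind (T₁ u s) * (∑ v, b u v * ind (¬ T₂ u v s)) ^ M₂) +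
          M₁ * M₂ * ∑ s, p s * ∑ u, a u * ∑ v, b u v * ind (T₁ u s ∧ T₂ u v s ∧ ¬ T₃ u v s)) +
        l₁ * (M₁ * ∑ s, p' s * ∑ u, a u * ind (B₁ u s)) +
        l₂ * (M₁ * M₂ * ∑ s, p' s * ∑ u, a u * ∑ v, b u v *
          ind (T₁ u s ∧ T₂ u v s ∧ T₃ u v s)) < 1) :
    ∃ (c : Fin M₁ → 𝒰) (e : Fin M₂ × 𝒰 → 𝒱),
      l₀ * ∑ s, p s * ind ((∀ i, ¬ T₁ (c i) s) ∨
          (∃ i, T₁ (c i) s ∧ ∀ j, ¬ T₂ (c i) (e (j, c i)) s) ∨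
          ∃ i j, T₁ (c i) s ∧ T₂ (c i) (e (j, c i)) s ∧ ¬ T₃ (c i) (e (j, c i)) s) +
        l₁ * ∑ s, p' s * ind (∃ i, B₁ (c i) s) +
        l₂ * ∑ s, p' s * ind (∃ i j, T₁ (c i) s ∧ T₂ (c i) (e (j, c i)) s ∧
          T₃ (c i) (e (j, c i)) s) < 1 := by
  let F : (Fin M₁ → 𝒰) × (Fin M₂ × 𝒰 → 𝒱) → ℝ := fun ce =>
    l₀ * ∑ s, p s * (∏ i, ind (¬ T₁ (ce.1 i) s) +
        ∑ i, ind (T₁ (ce.1 i) s) * ∏ j, ind (¬ T₂ (ce.1 i) (ce.2 (j, ce.1 i)) s) +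
        ∑ i, ∑ j, ind (T₁ (ce.1 i) s ∧ T₂ (ce.1 i) (ce.2 (j, ce.1 i)) s ∧
          ¬ T₃ (ce.1 i) (ce.2 (j, ce.1 i)) s)) +
      l₁ * ∑ s, p' s * ∑ i, ind (B₁ (ce.1 i) s) +
      l₂ * ∑ s, p' s * ∑ i, ∑ j, ind (T₁ (ce.1 i) s ∧ T₂ (ce.1 i) (ce.2 (j, ce.1 i)) s ∧
        T₃ (ce.1 i) (ce.2 (j, ce.1 i)) s)
  have hmean : ∑ ce, codebookWt a b ce * F ce < 1 := by
    refine lt_of_eq_of_lt ?_ hlt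
    have e1 : ∀ s, ∑ ce : (Fin M₁ → 𝒰) × (Fin M₂ × 𝒰 → 𝒱), codebookWt a b ce *
        ∏ i, ind (¬ T₁ (ce.1 i) s) = (∑ u, a u * ind (¬ T₁ u s)) ^ M₁ := fun s =>
      sum_codebookWt_mul_forall hb (fun u => ind (¬ T₁ u s))
    have e2 : ∀ s, ∑ ce : (Fin M₁ → 𝒰) × (Fin M₂ × 𝒰 → 𝒱), codebookWt a b ce *
        ∑ i, ind (T₁ (ce.1 i) s) * ∏ j, ind (¬ T₂ (ce.1 i) (ce.2 (j, ce.1 i)) s) =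
        M₁ * ∑ u, a u * (ind (T₁ u s) * (∑ v, b u v * ind (¬ T₂ u v s)) ^ M₂) := fun s => by
      simp_rw [Finset.mul_sum (s := (Finset.univ : Finset (Fin M₁)))]
      rw [Finset.sum_comm]
      simp_rw [sum_codebookWt_mul_miss ha hb _ (fun u => ind (T₁ u s))
        (fun u v => ind (¬ T₂ u v s))]
      simp
    have e3 : ∀ g : 𝒰 → 𝒱 → ℝ, ∑ ce : (Fin M₁ → 𝒰) × (Fin M₂ × 𝒰 → 𝒱), codebookWt a b ce *
        ∑ i, ∑ j, g (ce.1 i) (ce.2 (j, ce.1 i)) = M₁ * M₂ * ∑ u, a u * ∑ v, b u v * g u v := by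
      intro g
      simp_rw [Finset.mul_sum (s := (Finset.univ : Finset (Fin M₁))),
        Finset.mul_sum (s := (Finset.univ : Finset (Fin M₂)))]
      rw [Finset.sum_comm]
      have : ∀ i : Fin M₁, ∑ ce : (Fin M₁ → 𝒰) × (Fin M₂ × 𝒰 → 𝒱), ∑ j,
          codebookWt a b ce * g (ce.1 i) (ce.2 (j, ce.1 i)) =
          M₂ * ∑ u, a u * ∑ v, b u v * g u v := by
        intro i
        rw [Finset.sum_comm]
        simp_rw [sum_codebookWt_mul_pair ha hb i _ g]
        simp
      simp_rw [this]
      simp [mul_assoc]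
    have e4 : ∀ s, ∑ ce : (Fin M₁ → 𝒰) × (Fin M₂ × 𝒰 → 𝒱), codebookWt a b ce *
        ∑ i, ind (B₁ (ce.1 i) s) = M₁ * ∑ u, a u * ind (B₁ u s) := fun s => by
      simp_rw [Finset.mul_sum (s := (Finset.univ : Finset (Fin M₁)))]
      rw [Finset.sum_comm]
      simp_rw [sum_codebookWt_mul_single ha hb _ (fun u => ind (B₁ u s))]
      simp
    -- exchange the average over codebooks with the sums over `s`
    have ex : ∀ (r : 𝒮 → ℝ) (G : 𝒮 → (Fin M₁ → 𝒰) × (Fin M₂ × 𝒰 → 𝒱) → ℝ) (l : ℝ),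
        ∑ ce, codebookWt a b ce * (l * ∑ s, r s * G s ce) =
          l * ∑ s, r s * ∑ ce, codebookWt a b ce * G s ce := by
      intro r G l
      simp_rw [Finset.mul_sum]
      rw [Finset.sum_comm]
      refine Finset.sum_congr rfl fun s _ => Finset.sum_congr rfl fun ce _ => ?_
      ring
    simp only [F, mul_add (codebookWt a b _), Finset.sum_add_distrib]
    rw [ex, ex, ex]
    simp only [mul_add (codebookWt a b _), Finset.sum_add_distrib]
    simp_rw [e1, e2, e4]
    simp_rw [fun s => e3 (fun u v => ind (T₁ u s ∧ T₂ u v s ∧ ¬ T₃ u v s)),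
      fun s => e3 (fun u v => ind (T₁ u s ∧ T₂ u v s ∧ T₃ u v s))]
    simp only [mul_add (p _), Finset.sum_add_distrib, Finset.mul_sum, mul_left_comm]
  obtain ⟨ce, hce⟩ : ∃ ce, F ce < 1 := by
    by_contra! hge
    have := Finset.sum_le_sum fun ce (_ : ce ∈ Finset.univ) =>
      mul_le_mul_of_nonneg_left (hge ce) (codebookWt_nonneg ha0 hb0 ce)
    simp only [mul_one, sum_codebookWt ha hb] at this
    linarith
  refine ⟨ce.1, ce.2, lt_of_le_of_lt ?_ hce⟩
  have hex : ∀ P : Fin M₁ → Fin M₂ → Prop, ind (∃ i j, P i j) ≤ ∑ i, ∑ j, ind (P i j) := fun P =>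
    (ind_exists_le _).trans (Finset.sum_le_sum fun i _ => ind_exists_le _)
  refine add_le_add (add_le_add ?_ ?_) ?_
  · refine mul_le_mul_of_nonneg_left (Finset.sum_le_sum fun s _ => ?_) hl₀
    refine mul_le_mul_of_nonneg_left ?_ (hp s)
    refine (ind_or_le _ _).trans ?_
    rw [add_assoc]
    refine add_le_add (ind_forall _).le ((ind_or_le _ _).trans (add_le_add ?_ (hex _)))
    refine (ind_exists_le _).trans (Finset.sum_le_sum fun i _ => ?_)
    rw [ind_and, ind_forall]
  · refine mul_le_mul_of_nonneg_left (Finset.sum_le_sum fun s _ => ?_) hl₁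
    exact mul_le_mul_of_nonneg_left (ind_exists_le _) (hp' s)
  · refine mul_le_mul_of_nonneg_left (Finset.sum_le_sum fun s _ => ?_) hl₂
    exact mul_le_mul_of_nonneg_left (hex _) (hp' s)

/-- The covering lemma: `M` independent words of law `q s` all miss the set `T s` with small
probability, when `q s` dominates on `T s` the conditional law `J s / r s` up to the factor `t`
and `M * t` is large. -/
lemma sum_mul_miss_pow_le {σ ω : Type*} [Fintype σ] [Fintype ω] {r : σ → ℝ} {J q : σ → ω → ℝ}
    (hJ : ∀ s w, 0 ≤ J s w) (hJr : ∀ s, ∑ w, J s w = r s)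
    (hq : ∀ s w, 0 ≤ q s w) (hq1 : ∀ s, ∑ w, q s w = 1) (T : σ → ω → Prop) {t : ℝ}
    (hT : ∀ s w, T s w → t * J s w ≤ r s * q s w) (M : ℕ) :
    ∑ s, r s * (∑ w, q s w * ind (¬ T s w)) ^ M ≤
      ∑ s, ∑ w, J s w * ind (¬ T s w) + (∑ s, r s) * Real.exp (-(M * t)) := by
  rw [Finset.sum_mul, ← Finset.sum_add_distrib]
  refine Finset.sum_le_sum fun s _ => ?_
  have hr0 : 0 ≤ r s := hJr s ▸ Finset.sum_nonneg fun w _ => hJ s w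
  have hJn : 0 ≤ ∑ w, J s w * ind (¬ T s w) :=
    Finset.sum_nonneg fun w _ => mul_nonneg (hJ s w) (ind_nonneg _)
  rcases hr0.eq_or_lt with hr | hr
  · rw [← hr]; simpa using hJn
  set y := (∑ w, J s w * ind (T s w)) / r s with hy
  have hyr : r s * y = ∑ w, J s w * ind (T s w) := by rw [hy]; field_simp
  have hy0 : 0 ≤ y :=
    div_nonneg (Finset.sum_nonneg fun w _ => mul_nonneg (hJ s w) (ind_nonneg _)) hr0
  have hcompl : ∑ w, J s w * ind (¬ T s w) = r s * (1 - y) := by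
    rw [mul_sub, mul_one, hyr, ← hJr s, ← Finset.sum_sub_distrib]
    exact Finset.sum_congr rfl fun w _ => by rw [ind_not]; ring
  have hy1 : y ≤ 1 := by
    rw [hcompl] at hJn
    nlinarith
  have hmiss : ∑ w, q s w * ind (¬ T s w) ≤ 1 - t * y := by
    have h1 : ∑ w, q s w * ind (¬ T s w) = 1 - ∑ w, q s w * ind (T s w) := by
      rw [← hq1 s, ← Finset.sum_sub_distrib]
      exact Finset.sum_congr rfl fun w _ => by rw [ind_not]; ring
    have h2 : r s * (t * y) ≤ r s * ∑ w, q s w * ind (T s w) := by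
      rw [mul_left_comm, hyr, Finset.mul_sum, Finset.mul_sum]
      refine Finset.sum_le_sum fun w _ => ?_
      by_cases hw : T s w
      · simpa [ind_of hw] using hT s w hw
      · simp [ind_of_not hw]
    have := le_of_mul_le_mul_left h2 hr
    linarith
  have hpow : (∑ w, q s w * ind (¬ T s w)) ^ M ≤ Real.exp (-(M * t) * y) := by
    calc _ ≤ Real.exp (-(t * y)) ^ M := by
          refine pow_le_pow_left₀ (Finset.sum_nonneg fun w _ =>
            mul_nonneg (hq s w) (ind_nonneg _)) (hmiss.trans ?_) M
          have := Real.add_one_le_exp (-(t * y))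
          linarith
      _ = _ := by rw [← Real.exp_nat_mul]; congr 1; ring
  -- convexity of the exponential between `0` and `-(M * t)`
  have hconv : Real.exp (-(M * t) * y) ≤ (1 - y) + y * Real.exp (-(M * t)) := by
    have := convexOn_exp.2 (Set.mem_univ (0 : ℝ)) (Set.mem_univ (-(M * t)))
      (sub_nonneg.mpr hy1) hy0 (by ring)
    simpa [mul_comm] using this
  have hexp := Real.exp_pos (-(M * t))
  rw [hcompl, ← mul_add]
  refine mul_le_mul_of_nonneg_left (hpow.trans (hconv.trans ?_)) hr0
  nlinarith

end RandomCoding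

/-! ### Information densities and single-letter changes of measure -/

section SingleLetter

open scoped Classical

lemma pr_map_map {α β γ : Type*} (p : PMF α) (f : α → β) (g : β → γ) :
    (p.map f).map g = p.map fun a => g (f a) := PMF.map_comp f p g

lemma sum_pr_map_ite {α β γ : Type*} [Fintype β] (p : PMF α) (f : α → β) (g : β → γ) (c : γ) :
    ∑ b, (if g b = c then pr (p.map f) b else 0) = pr (p.map fun a => g (f a)) c := by
  rw [← pr_map (p.map f) g c, pr_map_map]

lemma pr_map_le {α β γ : Type*} [Fintype β] (p : PMF α) (f : α → β) (g : β → γ) (b : β) :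
    pr (p.map f) b ≤ pr (p.map fun a => g (f a)) (g b) := by
  rw [← pr_map_map p f g]; exact pr_le_pr_map _ g b

variable {U V X Y₁ Y₂ : Type*} [Fintype U] [Fintype V] [Fintype X] [Fintype Y₁] [Fintype Y₂]

/-- The information density of `I(U;X)`. -/
def infoUX (Q : PMF (U × V × X × Y₁ × Y₂)) (k : U × X) : ℝ :=
  Real.log (pr (Q.map fun ω => (cU ω, cX ω)) k / (pr (Q.map cU) k.1 * pr (Q.map cX) k.2))

/-- The information density of `I(V;Y₁|U)`. -/
def infoVY (Q : PMF (U × V × X × Y₁ × Y₂)) (k : V × Y₁ × U) : ℝ :=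
  Real.log (pr (Q.map fun ω => (cV ω, cY₁ ω, cU ω)) k * pr (Q.map cU) k.2.2 /
    (pr (Q.map fun ω => (cV ω, cU ω)) (k.1, k.2.2) * pr (Q.map fun ω => (cY₁ ω, cU ω)) k.2))

lemma sum_mul_infoUX (Q : PMF (U × V × X × Y₁ × Y₂)) :
    ∑ k, pr (Q.map fun ω => (cU ω, cX ω)) k * infoUX Q k = mutualInfo Q cU cX := by
  rw [Fintype.sum_prod_type]; rfl

lemma sum_mul_infoVY (Q : PMF (U × V × X × Y₁ × Y₂)) :
    ∑ k, pr (Q.map fun ω => (cV ω, cY₁ ω, cU ω)) k * infoVY Q k =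
      condMutualInfo Q cV cY₁ cU := by
  simp_rw [Fintype.sum_prod_type]; rfl

lemma mutualInfo_nonneg (Q : PMF (U × V × X × Y₁ × Y₂)) : 0 ≤ mutualInfo Q cU cX := by
  rw [← sum_mul_infoUX]
  have key : ∀ k : U × X, pr (Q.map fun ω => (cU ω, cX ω)) k -
      pr (Q.map cU) k.1 * pr (Q.map cX) k.2 ≤
      pr (Q.map fun ω => (cU ω, cX ω)) k * infoUX Q k := by
    intro k
    refine sub_le_mul_log_div (pr_nonneg _ _) (mul_nonneg (pr_nonneg _ _) (pr_nonneg _ _)) ?_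
    intro h0
    refine le_antisymm ?_ (pr_nonneg _ _)
    rcases mul_eq_zero.mp h0 with h | h
    · exact h ▸ pr_map_le Q (fun ω => (cU ω, cX ω)) Prod.fst k
    · exact h ▸ pr_map_le Q (fun ω => (cU ω, cX ω)) Prod.snd k
  refine le_trans (le_of_eq ?_) (Finset.sum_le_sum fun k _ => key k)
  rw [Finset.sum_sub_distrib, sum_pr, Fintype.sum_prod_type]
  simp_rw [← Finset.mul_sum]
  simp [sum_pr]

lemma condMutualInfo_nonneg (Q : PMF (U × V × X × Y₁ × Y₂)) : 0 ≤ condMutualInfo Q cV cY₁ cU := by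
  rw [← sum_mul_infoVY]
  have key : ∀ k : V × Y₁ × U, pr (Q.map fun ω => (cV ω, cY₁ ω, cU ω)) k -
      pr (Q.map fun ω => (cV ω, cU ω)) (k.1, k.2.2) * pr (Q.map fun ω => (cY₁ ω, cU ω)) k.2 /
        pr (Q.map cU) k.2.2 ≤
      pr (Q.map fun ω => (cV ω, cY₁ ω, cU ω)) k * infoVY Q k := by
    intro k
    unfold infoVY
    rw [← div_div_eq_mul_div (pr (Q.map fun ω => (cV ω, cY₁ ω, cU ω)) k)]
    refine sub_le_mul_log_div (pr_nonneg _ _)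
      (div_nonneg (mul_nonneg (pr_nonneg _ _) (pr_nonneg _ _)) (pr_nonneg _ _)) ?_
    intro h0
    refine le_antisymm ?_ (pr_nonneg _ _)
    rcases div_eq_zero_iff.mp h0 with h | h
    · rcases mul_eq_zero.mp h with h | h
      · exact h ▸ pr_map_le Q (fun ω => (cV ω, cY₁ ω, cU ω)) (fun k => (k.1, k.2.2)) k
      · exact h ▸ pr_map_le Q (fun ω => (cV ω, cY₁ ω, cU ω)) (fun k => k.2) k
    · exact h ▸ pr_map_le Q (fun ω => (cV ω, cY₁ ω, cU ω)) (fun k => k.2.2) k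
  refine le_trans (le_of_eq ?_) (Finset.sum_le_sum fun k _ => key k)
  rw [Finset.sum_sub_distrib, sum_pr]
  have hV : ∀ u, ∑ v, pr (Q.map fun ω => (cV ω, cU ω)) (v, u) = pr (Q.map cU) u := by
    intro u
    rw [← sum_pr_map_ite Q (fun ω => (cV ω, cU ω)) Prod.snd u, Fintype.sum_prod_type]
    simp
  have hY : ∀ u, ∑ y, pr (Q.map fun ω => (cY₁ ω, cU ω)) (y, u) = pr (Q.map cU) u := by
    intro u
    rw [← sum_pr_map_ite Q (fun ω => (cY₁ ω, cU ω)) Prod.snd u, Fintype.sum_prod_type]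
    simp
  have hsum : ∑ k : V × Y₁ × U, pr (Q.map fun ω => (cV ω, cU ω)) (k.1, k.2.2) *
      pr (Q.map fun ω => (cY₁ ω, cU ω)) k.2 / pr (Q.map cU) k.2.2 = 1 := by
    simp_rw [Fintype.sum_prod_type]
    simp_rw [Finset.sum_comm (s := (Finset.univ : Finset Y₁))]
    rw [Finset.sum_comm]
    simp_rw [← Finset.sum_div, ← Finset.mul_sum, hY, ← Finset.sum_mul, hV]
    rw [← sum_pr (Q.map cU)]
    refine Finset.sum_congr rfl fun u _ => ?_
    by_cases h : pr (Q.map cU) u = 0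
    · simp [h]
    · field_simp
  rw [hsum, sub_self]

/-- The conditional law of `V` given `U`; the value at a letter `u` of probability zero is
immaterial, and the law of `V` is used there. -/
def kernelVU (Q : PMF (U × V × X × Y₁ × Y₂)) (u : U) (v : V) : ℝ :=
  if pr (Q.map cU) u = 0 then pr (Q.map cV) v
  else pr (Q.map fun ω => (cV ω, cU ω)) (v, u) / pr (Q.map cU) u

lemma kernelVU_nonneg (Q : PMF (U × V × X × Y₁ × Y₂)) (u : U) (v : V) : 0 ≤ kernelVU Q u v := by
  unfold kernelVU
  split_ifs
  · exact pr_nonneg _ _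
  · exact div_nonneg (pr_nonneg _ _) (pr_nonneg _ _)

lemma sum_kernelVU (Q : PMF (U × V × X × Y₁ × Y₂)) (u : U) : ∑ v, kernelVU Q u v = 1 := by
  unfold kernelVU
  split_ifs with h
  · exact sum_pr _
  · rw [← Finset.sum_div, div_eq_one_iff_eq h]
    rw [← sum_pr_map_ite Q (fun ω => (cV ω, cU ω)) Prod.snd u, Fintype.sum_prod_type]
    simp

/-- Markov's identity `J * x' = j' * p` and the equality of conditional laws `j' * x = j * x'`
combine to `p * j = J * x`. -/
lemma mul_eq_mul_of_markov {J x' j' p x j : ℝ} (h₁ : J * x' = j' * p) (h₂ : j' * x = j * x')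
    (h₀ : x' = 0 → p = 0 ∧ J = 0) : p * j = J * x := by
  by_cases hx : x' = 0
  · obtain ⟨rfl, rfl⟩ := h₀ hx; simp
  · refine mul_right_cancel₀ hx ?_
    calc p * j * x' = p * (j * x') := by ring
      _ = (j' * p) * x := by rw [← h₂]; ring
      _ = J * x * x' := by rw [← h₁]; ring

/-- The law of `(U, X, Y₁, Y₂)`. -/
abbrev lawUS (Q : PMF (U × V × X × Y₁ × Y₂)) : PMF (U × X × Y₁ × Y₂) :=
  Q.map fun ω => (ω.1, ω.2.2)

/-- Change of measure in the first layer: drawing `U` independently of the sources instead of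
through the test channel `P_{U|X}` costs the information density. -/
lemma pr_mul_eq_lawUS_mul_exp {P' : PMF (X × Y₁ × Y₂)} {Q Q' : PMF (U × V × X × Y₁ × Y₂)}
    (hQ' : IsAuxiliaryLaw P' Q') (hs : SameConditional Q Q' cU cX) (u : U) (s : X × Y₁ × Y₂)
    (h : pr (Q.map fun ω => (cU ω, cX ω)) (u, s.1) ≠ 0) :
    pr (Q.map cU) u * pr P' s = pr (lawUS Q') (u, s) * Real.exp (-infoUX Q (u, s.1)) := by
  obtain ⟨x, y, z⟩ := s
  have hU : 0 < pr (Q.map cU) u := lt_of_lt_of_le (lt_of_le_of_ne (pr_nonneg _ _) h.symm)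
    (pr_map_le Q (fun ω => (cU ω, cX ω)) Prod.fst (u, x))
  have hX : 0 < pr (Q.map cX) x := lt_of_lt_of_le (lt_of_le_of_ne (pr_nonneg _ _) h.symm)
    (pr_map_le Q (fun ω => (cU ω, cX ω)) Prod.snd (u, x))
  have hj : 0 < pr (Q.map fun ω => (cU ω, cX ω)) (u, x) := lt_of_le_of_ne (pr_nonneg _ _) h.symm
  have h₁ : pr (lawUS Q') (u, x, y, z) * pr (Q'.map cX) x =
      pr (Q'.map fun ω => (cU ω, cX ω)) (u, x) * pr P' (x, y, z) := by
    have := congrArg ENNReal.toReal (hQ'.2.1 u x (y, z))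
    rw [ENNReal.toReal_mul, ENNReal.toReal_mul] at this
    rw [← hQ'.1]
    exact this
  have h₂ : pr (Q'.map fun ω => (cU ω, cX ω)) (u, x) * pr (Q.map cX) x =
      pr (Q.map fun ω => (cU ω, cX ω)) (u, x) * pr (Q'.map cX) x := by
    have := congrArg ENNReal.toReal (hs u x)
    rwa [ENNReal.toReal_mul, ENNReal.toReal_mul] at this
  have key := mul_eq_mul_of_markov h₁ h₂ (fun h0 => by
    constructor
    · refine le_antisymm (h0 ▸ ?_) (pr_nonneg _ _)
      rw [← hQ'.1]
      exact pr_map_le Q' (fun ω => (cX ω, cY₁ ω, cY₂ ω)) Prod.fst (x, y, z)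
    · refine le_antisymm (h0 ▸ ?_) (pr_nonneg _ _)
      exact pr_map_le Q' (fun ω => (ω.1, ω.2.2)) (fun k => k.2.1) (u, x, y, z))
  have hexp : Real.exp (-infoUX Q (u, x)) = pr (Q.map cU) u * pr (Q.map cX) x /
      pr (Q.map fun ω => (cU ω, cX ω)) (u, x) := by
    rw [infoUX, ← Real.log_inv, Real.exp_log (by positivity), inv_div]
  simp only
  rw [hexp]
  field_simp
  linear_combination key

/-- Change of measure in the second layer: drawing `V` from `P_{V|U}` instead of through the test
channel `P_{V|Y₁U}` costs the conditional information density. -/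
lemma kernelVU_mul_eq_pr_mul_exp {P' : PMF (X × Y₁ × Y₂)} {Q Q' : PMF (U × V × X × Y₁ × Y₂)}
    (hQ' : IsAuxiliaryLaw P' Q') (hs : SameConditional Q Q' cV fun ω => (cY₁ ω, cU ω))
    (u : U) (v : V) (s : X × Y₁ × Y₂)
    (h : pr (Q.map fun ω => (cV ω, cY₁ ω, cU ω)) (v, s.2.1, u) ≠ 0) :
    kernelVU Q u v * pr (lawUS Q') (u, s) =
      pr Q' (u, v, s) * Real.exp (-infoVY Q (v, s.2.1, u)) := by
  obtain ⟨x, y, z⟩ := s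
  have hj : 0 < pr (Q.map fun ω => (cV ω, cY₁ ω, cU ω)) (v, y, u) :=
    lt_of_le_of_ne (pr_nonneg _ _) h.symm
  have hU : 0 < pr (Q.map cU) u :=
    hj.trans_le (pr_map_le Q (fun ω => (cV ω, cY₁ ω, cU ω)) (fun k => k.2.2) (v, y, u))
  have hYU : 0 < pr (Q.map fun ω => (cY₁ ω, cU ω)) (y, u) :=
    hj.trans_le (pr_map_le Q (fun ω => (cV ω, cY₁ ω, cU ω)) (fun k => k.2) (v, y, u))
  have hVU : 0 < pr (Q.map fun ω => (cV ω, cU ω)) (v, u) :=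
    hj.trans_le (pr_map_le Q (fun ω => (cV ω, cY₁ ω, cU ω)) (fun k => (k.1, k.2.2)) (v, y, u))
  have hJ : pr (Q'.map fun ω => (cV ω, (cY₁ ω, cU ω), (cY₂ ω, cX ω))) (v, (y, u), (z, x)) =
      pr Q' (u, v, x, y, z) :=
    pr_map_injective Q' (g := fun ω => (cV ω, (cY₁ ω, cU ω), (cY₂ ω, cX ω)))
      (fun a b hab => by simp only [Prod.ext_iff, cU, cV, cX, cY₁, cY₂] at hab ⊢; tauto)
      (u, v, x, y, z)
  have hp : pr (Q'.map fun ω => ((cY₁ ω, cU ω), (cY₂ ω, cX ω))) ((y, u), (z, x)) =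
      pr (lawUS Q') (u, x, y, z) := by
    have := pr_map_injective (lawUS Q')
      (g := fun k : U × X × Y₁ × Y₂ => ((k.2.2.1, k.1), (k.2.2.2, k.2.1)))
      (fun a b hab => by simp only [Prod.ext_iff] at hab ⊢; tauto) (u, x, y, z)
    rw [lawUS, pr_map_map] at this
    exact this
  have h₁ : pr Q' (u, v, x, y, z) * pr (Q'.map fun ω => (cY₁ ω, cU ω)) (y, u) =
      pr (Q'.map fun ω => (cV ω, cY₁ ω, cU ω)) (v, y, u) * pr (lawUS Q') (u, x, y, z) := by
    have := congrArg ENNReal.toReal (hQ'.2.2 v (y, u) (z, x))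
    rw [ENNReal.toReal_mul, ENNReal.toReal_mul] at this
    rw [← hJ, ← hp]
    exact this
  have h₂ : pr (Q'.map fun ω => (cV ω, cY₁ ω, cU ω)) (v, y, u) *
      pr (Q.map fun ω => (cY₁ ω, cU ω)) (y, u) =
      pr (Q.map fun ω => (cV ω, cY₁ ω, cU ω)) (v, y, u) *
        pr (Q'.map fun ω => (cY₁ ω, cU ω)) (y, u) := by
    have := congrArg ENNReal.toReal (hs v (y, u))
    rwa [ENNReal.toReal_mul, ENNReal.toReal_mul] at this
  have key := mul_eq_mul_of_markov h₁ h₂ (fun h0 => by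
    constructor
    · refine le_antisymm (h0 ▸ ?_) (pr_nonneg _ _)
      exact pr_map_le Q' (fun ω => (ω.1, ω.2.2)) (fun k => (k.2.2.1, k.1)) (u, x, y, z)
    · refine le_antisymm (h0 ▸ ?_) (pr_nonneg _ _)
      exact pr_le_pr_map Q' (fun ω => (cY₁ ω, cU ω)) (u, v, x, y, z))
  have hexp : Real.exp (-infoVY Q (v, y, u)) = pr (Q.map fun ω => (cV ω, cU ω)) (v, u) *
      pr (Q.map fun ω => (cY₁ ω, cU ω)) (y, u) /
      (pr (Q.map fun ω => (cV ω, cY₁ ω, cU ω)) (v, y, u) * pr (Q.map cU) u) := by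
    rw [infoVY, ← Real.log_inv, Real.exp_log (by positivity), inv_div]
  simp only
  rw [hexp, kernelVU, if_neg hU.ne']
  field_simp
  linear_combination key

end SingleLetter

/-! ### Changes of measure and covering for blocks -/

section BlockEstimates

open scoped Classical

lemma blockProb_map {α β : Type*} [Fintype α] [Fintype β] (p : PMF α) (g : α → β) (n : ℕ)
    (A : Set (Fin n → β)) :
    blockProb (p.map g) n A = blockProb p n {s | (fun t => g (s t)) ∈ A} := by
  have h : ∀ τ : Fin n → β, blockPr (p.map g) τ =
      ∑ s : Fin n → α, if (fun t => g (s t)) = τ then blockPr p s else 0 := by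
    intro τ
    unfold blockPr
    simp_rw [pr_map]
    rw [Finset.prod_univ_sum, Fintype.piFinset_univ]
    refine Finset.sum_congr rfl fun s _ => ?_
    split_ifs with hs
    · exact Finset.prod_congr rfl fun t _ => if_pos (congrFun hs t)
    · obtain ⟨t, ht⟩ := Function.ne_iff.mp hs
      exact Finset.prod_eq_zero (Finset.mem_univ t) (if_neg ht)
  unfold blockProb
  simp_rw [h, ← Finset.sum_filter]
  rw [Finset.sum_comm' (t' := {s : Fin n → α | (fun t => g (s t)) ∈ A})
    (s' := fun s => {fun t => g (s t)})]
  · simp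
  · intro τ s
    simp only [Finset.mem_filter, Finset.mem_univ, true_and, Finset.mem_singleton]
    constructor
    · rintro ⟨h1, rfl⟩; exact ⟨rfl, h1⟩
    · rintro ⟨rfl, h1⟩; exact ⟨h1, rfl⟩

lemma blockProb_eq_sum_ind {α : Type*} [Fintype α] (p : PMF α) (n : ℕ) (A : Set (Fin n → α)) :
    blockProb p n A = ∑ s : Fin n → α, blockPr p s * ind (s ∈ A) :=
  Finset.sum_congr rfl fun s _ => by unfold ind; split_ifs <;> simp

lemma sum_sum_eq_sum_zip {α β : Type*} [Fintype α] [Fintype β] {n : ℕ}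
    (F : (Fin n → α) → (Fin n → β) → ℝ) :
    ∑ b, ∑ a, F a b = ∑ τ : Fin n → α × β, F (fun t => (τ t).1) (fun t => (τ t).2) := by
  rw [Finset.sum_comm, ← Fintype.sum_prod_type']
  exact (Fintype.sum_equiv (Equiv.arrowProdEquivProdArrow (Fin n) (fun _ => α) (fun _ => β)) _ _
    fun τ => rfl).symm

lemma pr_map_snd {α β : Type*} [Fintype α] [Fintype β] (p : PMF (α × β)) (b : β) :
    pr (p.map Prod.snd) b = ∑ a, pr p (a, b) := by
  rw [pr_map, Fintype.sum_prod_type]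
  simp

/-- Marginal probabilities of blocks. -/
lemma sum_blockPr_eq {α β γ : Type*} [Fintype α] [Fintype γ] (p : PMF α)
    (r : PMF β) {n : ℕ} (f : β → γ → α) (h : ∀ b, ∑ c, pr p (f b c) = pr r b) (s : Fin n → β) :
    ∑ w : Fin n → γ, blockPr p (fun t => f (s t) (w t)) = blockPr r s := by
  unfold blockPr
  simp_rw [← h]
  rw [Finset.prod_univ_sum, Fintype.piFinset_univ]

variable {U V X Y₁ Y₂ : Type*} [Fintype U] [Fintype V] [Fintype X] [Fintype Y₁] [Fintype Y₂]
  {P' : PMF (X × Y₁ × Y₂)} {Q Q' : PMF (U × V × X × Y₁ × Y₂)} {n : ℕ}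

/-- Typicality of a first-layer word with the block observed by the sensor. -/
def TypUX (Q : PMF (U × V × X × Y₁ × Y₂)) (δ : ℝ) (u : Fin n → U) (s : Fin n → X × Y₁ × Y₂) :
    Prop :=
  Typ (Q.map fun ω => (cU ω, cX ω)) δ fun t => (u t, (s t).1)

/-- Typicality of a pair of words with the block observed by Detector 1. -/
def TypVYU (Q : PMF (U × V × X × Y₁ × Y₂)) (δ : ℝ) (u : Fin n → U) (v : Fin n → V)
    (s : Fin n → X × Y₁ × Y₂) : Prop :=
  Typ (Q.map fun ω => (cV ω, cY₁ ω, cU ω)) δ fun t => (v t, (s t).2.1, u t)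

/-- Typicality of a pair of words with the block observed by Detector 2. -/
def TypUVY (Q : PMF (U × V × X × Y₁ × Y₂)) (δ : ℝ) (u : Fin n → U) (v : Fin n → V)
    (s : Fin n → X × Y₁ × Y₂) : Prop :=
  Typ (Q.map fun ω => (cU ω, cV ω, cY₂ ω)) δ fun t => (u t, v t, (s t).2.2)

/-- The conditional law of the second-layer words. -/
def kernelBlock (Q : PMF (U × V × X × Y₁ × Y₂)) (u : Fin n → U) (v : Fin n → V) : ℝ :=
  ∏ t, kernelVU Q (u t) (v t)

lemma kernelBlock_nonneg (u : Fin n → U) (v : Fin n → V) : 0 ≤ kernelBlock Q u v :=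
  Finset.prod_nonneg fun _ _ => kernelVU_nonneg Q _ _

lemma sum_kernelBlock (u : Fin n → U) : ∑ v, kernelBlock Q u v = 1 := by
  unfold kernelBlock
  rw [← Fintype.piFinset_univ, ← Finset.prod_univ_sum]
  simp [sum_kernelVU]

lemma blockPr_mul_eq_lawUS (hQ' : IsAuxiliaryLaw P' Q') (hs : SameConditional Q Q' cU cX) {δ : ℝ}
    {u : Fin n → U} {s : Fin n → X × Y₁ × Y₂} (h : TypUX Q δ u s) :
    blockPr P' s * blockPr (Q.map cU) u =
      blockPr (lawUS Q') (fun t => (u t, s t)) * Real.exp (-∑ t, infoUX Q (u t, (s t).1)) := by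
  unfold blockPr
  rw [← Finset.sum_neg_distrib, Real.exp_sum, ← Finset.prod_mul_distrib,
    ← Finset.prod_mul_distrib]
  refine Finset.prod_congr rfl fun t _ => ?_
  rw [mul_comm]
  exact pr_mul_eq_lawUS_mul_exp hQ' hs (u t) (s t) (h.2 t)

lemma kernelBlock_mul_eq_blockPr (hQ' : IsAuxiliaryLaw P' Q')
    (hs : SameConditional Q Q' cV fun ω => (cY₁ ω, cU ω)) {δ : ℝ}
    {u : Fin n → U} {v : Fin n → V} {s : Fin n → X × Y₁ × Y₂} (h : TypVYU Q δ u v s) :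
    blockPr (lawUS Q') (fun t => (u t, s t)) * kernelBlock Q u v =
      blockPr Q' (fun t => (u t, v t, s t)) *
        Real.exp (-∑ t, infoVY Q (v t, (s t).2.1, u t)) := by
  unfold blockPr kernelBlock
  rw [← Finset.sum_neg_distrib, Real.exp_sum, ← Finset.prod_mul_distrib,
    ← Finset.prod_mul_distrib]
  refine Finset.prod_congr rfl fun t _ => ?_
  rw [mul_comm]
  exact kernelVU_mul_eq_pr_mul_exp hQ' hs (u t) (v t) (s t) (h.2 t)

lemma TypUX.abs_sum_infoUX_le {δ η : ℝ} (hη : δ * ∑ k, |infoUX Q k| ≤ η) {u : Fin n → U}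
    {s : Fin n → X × Y₁ × Y₂} (h : TypUX Q δ u s) :
    |∑ t, infoUX Q (u t, (s t).1) - n * mutualInfo Q cU cX| ≤ n * η := by
  have := Typ.abs_sum_sub_le h (infoUX Q)
  rw [sum_mul_infoUX] at this
  exact this.trans (mul_le_mul_of_nonneg_left hη (Nat.cast_nonneg n))

lemma TypVYU.abs_sum_infoVY_le {δ η : ℝ} (hη : δ * ∑ k, |infoVY Q k| ≤ η) {u : Fin n → U}
    {v : Fin n → V} {s : Fin n → X × Y₁ × Y₂} (h : TypVYU Q δ u v s) :
    |∑ t, infoVY Q (v t, (s t).2.1, u t) - n * condMutualInfo Q cV cY₁ cU| ≤ n * η := by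
  have := Typ.abs_sum_sub_le h (infoVY Q)
  rw [sum_mul_infoVY] at this
  exact this.trans (mul_le_mul_of_nonneg_left hη (Nat.cast_nonneg n))

lemma blockPr_mul_le_lawUS (hQ' : IsAuxiliaryLaw P' Q') (hs : SameConditional Q Q' cU cX)
    {δ η : ℝ} (hη : δ * ∑ k, |infoUX Q k| ≤ η) {u : Fin n → U} {s : Fin n → X × Y₁ × Y₂}
    (h : TypUX Q δ u s) :
    blockPr P' s * blockPr (Q.map cU) u ≤
      Real.exp (-(n * (mutualInfo Q cU cX - η))) * blockPr (lawUS Q') (fun t => (u t, s t)) := by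
  rw [blockPr_mul_eq_lawUS hQ' hs h, mul_comm]
  refine mul_le_mul_of_nonneg_right (Real.exp_le_exp.mpr ?_) (blockPr_nonneg _ _)
  have := (abs_le.mp (h.abs_sum_infoUX_le hη)).1
  linarith

lemma lawUS_mul_kernelBlock_le (hQ' : IsAuxiliaryLaw P' Q')
    (hs : SameConditional Q Q' cV fun ω => (cY₁ ω, cU ω)) {δ η : ℝ}
    (hη : δ * ∑ k, |infoVY Q k| ≤ η) {u : Fin n → U} {v : Fin n → V} {s : Fin n → X × Y₁ × Y₂}
    (h : TypVYU Q δ u v s) :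
    blockPr (lawUS Q') (fun t => (u t, s t)) * kernelBlock Q u v ≤
      Real.exp (-(n * (condMutualInfo Q cV cY₁ cU - η))) *
        blockPr Q' (fun t => (u t, v t, s t)) := by
  rw [kernelBlock_mul_eq_blockPr hQ' hs h, mul_comm]
  refine mul_le_mul_of_nonneg_right (Real.exp_le_exp.mpr ?_) (blockPr_nonneg _ _)
  have := (abs_le.mp (h.abs_sum_infoVY_le hη)).1
  linarith

/-- An event that forces typicality of an independently drawn first-layer word is no more likely
than under the law with the test channel, up to the factor `exp (-n I(U;X))`. -/
lemma sum_first_layer_le (hQ' : IsAuxiliaryLaw P' Q') (hs : SameConditional Q Q' cU cX)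
    {δ η : ℝ} (hη : δ * ∑ k, |infoUX Q k| ≤ η)
    (B : (Fin n → U) → (Fin n → X × Y₁ × Y₂) → Prop) (hB : ∀ u s, B u s → TypUX Q δ u s) :
    ∑ s, blockPr P' s * ∑ u, blockPr (Q.map cU) u * ind (B u s) ≤
      Real.exp (-(n * (mutualInfo Q cU cX - η))) *
        blockProb (lawUS Q') n {τ | B (fun t => (τ t).1) (fun t => (τ t).2)} := by
  have hz : blockProb (lawUS Q') n {τ | B (fun t => (τ t).1) (fun t => (τ t).2)} =
      ∑ s, ∑ u, blockPr (lawUS Q') (fun t => (u t, s t)) * ind (B u s) := by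
    rw [blockProb_eq_sum_ind, sum_sum_eq_sum_zip (fun u s =>
      blockPr (lawUS Q') (fun t => (u t, s t)) * ind (B u s))]
    rfl
  rw [hz, Finset.mul_sum]
  refine Finset.sum_le_sum fun s _ => ?_
  rw [Finset.mul_sum, Finset.mul_sum]
  refine Finset.sum_le_sum fun u _ => ?_
  by_cases h : B u s
  · simp only [ind_of h, mul_one]
    exact blockPr_mul_le_lawUS hQ' hs hη (hB u s h)
  · simp [ind_of_not h]

/-- The two-layer analogue of `sum_first_layer_le`. -/
lemma sum_second_layer_le (hQ' : IsAuxiliaryLaw P' Q') (hs : SameConditional Q Q' cU cX)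
    (hs' : SameConditional Q Q' cV fun ω => (cY₁ ω, cU ω))
    {δ₁ η₁ δ₂ η₂ : ℝ} (hη₁ : δ₁ * ∑ k, |infoUX Q k| ≤ η₁) (hη₂ : δ₂ * ∑ k, |infoVY Q k| ≤ η₂)
    (B : (Fin n → U) → (Fin n → V) → (Fin n → X × Y₁ × Y₂) → Prop)
    (hB : ∀ u v s, B u v s → TypUX Q δ₁ u s ∧ TypVYU Q δ₂ u v s) :
    ∑ s, blockPr P' s * ∑ u, blockPr (Q.map cU) u * ∑ v, kernelBlock Q u v * ind (B u v s) ≤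
      Real.exp (-(n * (mutualInfo Q cU cX - η₁))) *
        (Real.exp (-(n * (condMutualInfo Q cV cY₁ cU - η₂))) *
        blockProb Q' n
          {τ | B (fun t => (τ t).1) (fun t => (τ t).2.1) (fun t => (τ t).2.2)}) := by
  rw [blockProb_eq_sum_ind]
  have hz : ∑ τ : Fin n → U × V × X × Y₁ × Y₂, blockPr Q' τ *
      ind (τ ∈ {τ : Fin n → U × V × X × Y₁ × Y₂ |
        B (fun t => (τ t).1) (fun t => (τ t).2.1) (fun t => (τ t).2.2)}) =
      ∑ s, ∑ u, ∑ v, blockPr Q' (fun t => (u t, v t, s t)) * ind (B u v s) := by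
    rw [Finset.sum_congr rfl fun s _ => Finset.sum_comm,
      sum_sum_eq_sum_zip (fun v s => ∑ u, blockPr Q' (fun t => (u t, v t, s t)) * ind (B u v s)),
      sum_sum_eq_sum_zip (fun u (w : Fin n → V × X × Y₁ × Y₂) =>
        blockPr Q' (fun t => (u t, (w t).1, (w t).2)) *
          ind (B u (fun t => (w t).1) (fun t => (w t).2)))]
    rfl
  rw [hz]
  simp_rw [Finset.mul_sum]
  refine Finset.sum_le_sum fun s _ => Finset.sum_le_sum fun u _ => Finset.sum_le_sum fun v _ => ?_
  by_cases h : B u v s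
  · simp only [ind_of h, mul_one]
    obtain ⟨h1, h2⟩ := hB u v s h
    calc blockPr P' s * (blockPr (Q.map cU) u * kernelBlock Q u v)
        = blockPr P' s * blockPr (Q.map cU) u * kernelBlock Q u v := by ring
      _ ≤ Real.exp (-(n * (mutualInfo Q cU cX - η₁))) *
            blockPr (lawUS Q') (fun t => (u t, s t)) * kernelBlock Q u v :=
          mul_le_mul_of_nonneg_right (blockPr_mul_le_lawUS hQ' hs hη₁ h1) (kernelBlock_nonneg u v)
      _ = Real.exp (-(n * (mutualInfo Q cU cX - η₁))) *
            (blockPr (lawUS Q') (fun t => (u t, s t)) * kernelBlock Q u v) := by ring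
      _ ≤ _ := mul_le_mul_of_nonneg_left (lawUS_mul_kernelBlock_le hQ' hs' hη₂ h2)
          (Real.exp_pos _).le
  · simp [ind_of_not h]

lemma SameConditional.refl {Ω α β : Type*} (p : PMF Ω) (A : Ω → α) (B : Ω → β) :
    SameConditional p p A B := fun _ _ => rfl

lemma sum_lawUS (hQ : IsAuxiliaryLaw P' Q) (s : Fin n → X × Y₁ × Y₂) :
    ∑ u : Fin n → U, blockPr (lawUS Q) (fun t => (u t, s t)) = blockPr P' s := by
  refine sum_blockPr_eq (lawUS Q) P' (fun s u => (u, s)) (fun s => ?_) s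
  have : P' = (lawUS Q).map Prod.snd := by
    rw [lawUS, pr_map_map]; exact hQ.1.symm
  rw [this, pr_map_snd]

lemma sum_blockPr_eq_lawUS (u : Fin n → U) (s : Fin n → X × Y₁ × Y₂) :
    ∑ v : Fin n → V, blockPr Q (fun t => (u t, v t, s t)) =
      blockPr (lawUS Q) (fun t => (u t, s t)) := by
  refine sum_blockPr_eq Q (lawUS Q) (fun k v => (k.1, v, k.2)) (fun k => ?_) (fun t => (u t, s t))
  rw [lawUS, pr_map, Fintype.sum_prod_type, Finset.sum_eq_single k.1]
  · rw [Fintype.sum_prod_type]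
    refine Finset.sum_congr rfl fun v _ => ?_
    rw [Finset.sum_eq_single k.2]
    · simp
    · intro s _ h
      exact if_neg fun h' => h (congrArg Prod.snd h')
    · simp
  · intro u' _ h
    refine Finset.sum_eq_zero fun w _ => if_neg fun h' => h (congrArg Prod.fst h')
  · simp

/-- The probability that no first-layer word fits the block observed by the sensor. -/
lemma first_layer_covering (hQ : IsAuxiliaryLaw P' Q) {δ η : ℝ}
    (hη : δ * ∑ k, |infoUX Q k| ≤ η) (M : ℕ) :
    ∑ s : Fin n → X × Y₁ × Y₂, blockPr P' s *
        (∑ u, blockPr (Q.map cU) u * ind (¬ TypUX Q δ u s)) ^ M ≤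
      blockProb (lawUS Q) n {τ | ¬ TypUX Q δ (fun t => (τ t).1) (fun t => (τ t).2)} +
        Real.exp (-(M * Real.exp (-(n * (mutualInfo Q cU cX + η))))) := by
  have := sum_mul_miss_pow_le (r := fun s : Fin n → X × Y₁ × Y₂ => blockPr P' s)
    (J := fun s (u : Fin n → U) => blockPr (lawUS Q) (fun t => (u t, s t)))
    (q := fun _ u => blockPr (Q.map cU) u) (fun _ _ => blockPr_nonneg _ _)
    (fun s => sum_lawUS hQ s) (fun _ _ => blockPr_nonneg _ _) (fun _ => sum_blockPr _ n)
    (fun s u => TypUX Q δ u s) (t := Real.exp (-(n * (mutualInfo Q cU cX + η))))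
    (fun s u h => by
      rw [blockPr_mul_eq_lawUS hQ (SameConditional.refl Q _ _) h, mul_comm]
      refine mul_le_mul_of_nonneg_left (Real.exp_le_exp.mpr ?_) (blockPr_nonneg _ _)
      have := (abs_le.mp (h.abs_sum_infoUX_le hη)).2
      linarith) M
  rw [sum_blockPr, one_mul] at this
  refine this.trans (add_le_add (le_of_eq ?_) le_rfl)
  rw [blockProb_eq_sum_ind, sum_sum_eq_sum_zip (fun u s =>
    blockPr (lawUS Q) (fun t => (u t, s t)) * ind (¬ TypUX Q δ u s))]
  rfl

/-- The probability that some fitting first-layer word has no second-layer word that fits the block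
observed by Detector 1, before the union bound over the first-layer words. -/
lemma second_layer_covering (hQ : IsAuxiliaryLaw P' Q) {δ₁ η₁ δ₂ η₂ : ℝ}
    (hη₁ : δ₁ * ∑ k, |infoUX Q k| ≤ η₁) (hη₂ : δ₂ * ∑ k, |infoVY Q k| ≤ η₂) (M : ℕ) :
    ∑ s : Fin n → X × Y₁ × Y₂, blockPr P' s * ∑ u, blockPr (Q.map cU) u *
        (ind (TypUX Q δ₁ u s) * (∑ v, kernelBlock Q u v * ind (¬ TypVYU Q δ₂ u v s)) ^ M) ≤
      Real.exp (-(n * (mutualInfo Q cU cX - η₁))) *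
        (blockProb Q n
          {τ | ¬ TypVYU Q δ₂ (fun t => (τ t).1) (fun t => (τ t).2.1) (fun t => (τ t).2.2)} +
        Real.exp (-(M * Real.exp (-(n * (condMutualInfo Q cV cY₁ cU + η₂)))))) := by
  have key := sum_mul_miss_pow_le
    (r := fun τ : Fin n → U × X × Y₁ × Y₂ => blockPr (lawUS Q) τ)
    (J := fun τ (v : Fin n → V) => blockPr Q (fun t => ((τ t).1, v t, (τ t).2)))
    (q := fun τ v => kernelBlock Q (fun t => (τ t).1) v) (fun _ _ => blockPr_nonneg _ _)
    (fun τ => sum_blockPr_eq_lawUS (fun t => (τ t).1) (fun t => (τ t).2))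
    (fun _ _ => kernelBlock_nonneg _ _) (fun _ => sum_kernelBlock _)
    (fun τ v => TypVYU Q δ₂ (fun t => (τ t).1) v (fun t => (τ t).2))
    (t := Real.exp (-(n * (condMutualInfo Q cV cY₁ cU + η₂))))
    (fun τ v h => by
      refine le_of_le_of_eq ?_ (kernelBlock_mul_eq_blockPr hQ (SameConditional.refl Q _ _) h).symm
      rw [mul_comm]
      refine mul_le_mul_of_nonneg_left (Real.exp_le_exp.mpr ?_) (blockPr_nonneg _ _)
      have := (abs_le.mp (h.abs_sum_infoVY_le hη₂)).2
      linarith) M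
  rw [sum_blockPr, one_mul] at key
  have hz : ∑ τ : Fin n → U × X × Y₁ × Y₂, ∑ v : Fin n → V,
      blockPr Q (fun t => ((τ t).1, v t, (τ t).2)) *
        ind (¬ TypVYU Q δ₂ (fun t => (τ t).1) v (fun t => (τ t).2)) =
      blockProb Q n
        {τ | ¬ TypVYU Q δ₂ (fun t => (τ t).1) (fun t => (τ t).2.1) (fun t => (τ t).2.2)} := by
    rw [blockProb_eq_sum_ind, ← sum_sum_eq_sum_zip (fun u s => ∑ v : Fin n → V,
      blockPr Q (fun t => (u t, v t, s t)) * ind (¬ TypVYU Q δ₂ u v s)),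
      Finset.sum_congr rfl fun s _ => Finset.sum_comm,
      sum_sum_eq_sum_zip (fun v s => ∑ u, blockPr Q (fun t => (u t, v t, s t)) *
        ind (¬ TypVYU Q δ₂ u v s)),
      sum_sum_eq_sum_zip (fun u (w : Fin n → V × X × Y₁ × Y₂) =>
        blockPr Q (fun t => (u t, (w t).1, (w t).2)) *
          ind (¬ TypVYU Q δ₂ u (fun t => (w t).1) (fun t => (w t).2)))]
    rfl
  rw [hz] at key
  refine le_trans ?_ (mul_le_mul_of_nonneg_left key (Real.exp_pos _).le)
  rw [← sum_sum_eq_sum_zip (fun u s => blockPr (lawUS Q) (fun t => (u t, s t)) *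
    (∑ v, kernelBlock Q u v * ind (¬ TypVYU Q δ₂ u v s)) ^ M), Finset.mul_sum]
  refine Finset.sum_le_sum fun s _ => ?_
  rw [Finset.mul_sum, Finset.mul_sum]
  refine Finset.sum_le_sum fun u _ => ?_
  have hnn : 0 ≤ (∑ v, kernelBlock Q u v * ind (¬ TypVYU Q δ₂ u v s)) ^ M :=
    pow_nonneg (Finset.sum_nonneg fun v _ => mul_nonneg (kernelBlock_nonneg _ _) (ind_nonneg _)) M
  by_cases h : TypUX Q δ₁ u s
  · rw [ind_of h, one_mul, ← mul_assoc, ← mul_assoc]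
    exact mul_le_mul_of_nonneg_right
      (blockPr_mul_le_lawUS hQ (SameConditional.refl Q _ _) hη₁ h) hnn
  · rw [ind_of_not h, zero_mul, mul_zero, mul_zero]
    exact mul_nonneg (Real.exp_pos _).le (mul_nonneg (blockPr_nonneg _ _) hnn)

end BlockEstimates

/-! ### Exponents of the acceptance regions -/

section Exponents

open scoped Classical

lemma Typ.mono {α : Type*} [Fintype α] {p : PMF α} {δ δ' : ℝ} {n : ℕ} {s : Fin n → α}
    (h : Typ p δ s) (hδ : δ ≤ δ') : Typ p δ' s := ⟨fun a => (h.1 a).trans hδ, h.2⟩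

/-- Marginals of typical blocks are typical, with a loss in the constant. -/
lemma Typ.abs_emp_comp_sub_le {α β : Type*} [Fintype α] [Fintype β] {p : PMF α} {δ : ℝ}
    (hδ : 0 ≤ δ) {n : ℕ} {s : Fin n → α} (h : Typ p δ s) (g : α → β) (b : β) :
    |emp (fun t => g (s t)) b - pr (p.map g) b| ≤ Fintype.card α * δ := by
  rw [emp_comp, pr_map, ← Finset.sum_sub_distrib]
  refine (Finset.abs_sum_le_sum_abs _ _).trans ?_
  refine (Finset.sum_le_sum (g := fun _ => δ) fun a _ => ?_).trans (by simp)
  split_ifs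
  · exact h.1 a
  · simpa using hδ

/-- The image of the vector `q` under `g`; for a probability vector, a marginal. -/
def marg {α β : Type*} [Fintype α] (g : α → β) (q : α → ℝ) (b : β) : ℝ :=
  ∑ a, if g a = b then q a else 0

lemma marg_pr {α β : Type*} [Fintype α] (p : PMF α) (g : α → β) (b : β) :
    marg g (pr p) b = pr (p.map g) b := (pr_map p g b).symm

lemma marg_emp {α β : Type*} [Fintype α] [Fintype β] {n : ℕ} (s : Fin n → α) (g : α → β) (b : β) :
    marg g (emp s) b = emp (fun t => g (s t)) b := (emp_comp s g b).symm

lemma continuous_marg {α β : Type*} [Fintype α] (g : α → β) (b : β) :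
    Continuous fun q => marg g q b :=
  continuous_finsetSum _ fun a _ => by
    by_cases h : g a = b
    · simpa only [h, if_true] using continuous_apply a
    · simpa only [h, if_false] using continuous_const

variable {U V X Y₁ Y₂ : Type*} [Fintype U] [Fintype V] [Fintype X] [Fintype Y₁] [Fintype Y₂]

/-- Under the law with the alternative test channels, the blocks look acceptable to Detector 1 with
exponent at least `θ`. -/
lemma exists_exponent_detector₁ (Q Qbar : PMF (U × V × X × Y₁ × Y₂)) {θ ε : ℝ} (hε : 0 < ε)
    (h : ENNReal.ofReal θ ≤ ⨅ q ∈ L₁ Q,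
      relEntropy q (Qbar.map fun ω => (cU ω, cX ω, cY₁ ω))) :
    ∃ δ : ℝ, 0 < δ ∧ ∃ C : ℝ, 0 < C ∧ ∀ n : ℕ, 0 < n →
      blockProb (lawUS Qbar) n {τ | TypUX Q δ (fun t => (τ t).1) (fun t => (τ t).2) ∧
        ∃ v, TypVYU Q δ (fun t => (τ t).1) v (fun t => (τ t).2)} ≤
      C * Real.exp (-(n * (θ - ε))) := by
  let L : (U × X) ⊕ (U × Y₁) → (U × X × Y₁ → ℝ) → ℝ := Sum.elim
    (fun k q => marg (fun a => (a.1, a.2.1)) q k)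
    (fun k q => marg (fun a => (a.1, a.2.2)) q k)
  let m : (U × X) ⊕ (U × Y₁) → ℝ := Sum.elim
    (fun k => pr (Q.map fun ω => (cU ω, cX ω)) k) (fun k => pr (Q.map fun ω => (cU ω, cY₁ ω)) k)
  have hL : ∀ i, Continuous (L i) := by
    rintro (k | k) <;> exact continuous_marg _ _
  obtain ⟨δ, hδ, C, hC, hb⟩ := exists_blockProb_near_le
    (Qbar.map fun ω => (cU ω, cX ω, cY₁ ω)) L hL m hε (θ := θ) (by
      intro q hq
      refine h.trans (iInf₂_le q ⟨?_, ?_⟩)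
      · refine pmf_ext_of_pr fun k => ?_
        rw [← marg_pr]; exact hq (Sum.inl k)
      · refine pmf_ext_of_pr fun k => ?_
        rw [← marg_pr]; exact hq (Sum.inr k))
  -- the denominator pays for passing from the typicality of `(v, y₁, u)` to that of `(u, y₁)`
  refine ⟨δ / (Fintype.card (V × Y₁ × U) + 1), by positivity, C, hC, fun n hn => ?_⟩
  refine le_trans ?_ (hb n hn)
  have hmap : Qbar.map (fun ω => (cU ω, cX ω, cY₁ ω)) =
      (lawUS Qbar).map fun k => (k.1, k.2.1, k.2.2.1) := by
    rw [lawUS, pr_map_map]; rfl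
  rw [hmap, blockProb_map (lawUS Qbar) (fun k => (k.1, k.2.1, k.2.2.1))]
  refine blockProb_mono _ _ ?_
  rintro τ ⟨h1, v, h2⟩ (k | k)
  · have := (h1.mono (div_le_self hδ.le (le_add_of_nonneg_left (Nat.cast_nonneg _)))).1 k
    have he := marg_emp (fun t => ((τ t).1, (τ t).2.1, (τ t).2.2.1))
      (fun a : U × X × Y₁ => (a.1, a.2.1)) k
    simp only [L, m, Sum.elim_inl]
    rw [he]
    exact this
  · have := Typ.abs_emp_comp_sub_le (by positivity) h2 (fun k => (k.2.2, k.2.1)) k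
    have he := marg_emp (fun t => ((τ t).1, (τ t).2.1, (τ t).2.2.1))
      (fun a : U × X × Y₁ => (a.1, a.2.2)) k
    simp only [L, m, Sum.elim_inr]
    rw [he]
    rw [pr_map_map] at this
    refine this.trans ?_
    rw [mul_div_assoc', div_le_iff₀ (by positivity)]
    nlinarith

/-- Under the law with the alternative test channels, the blocks look acceptable to Detector 2 with
exponent at least `θ`. -/
lemma exists_exponent_detector₂ (Q Qbar : PMF (U × V × X × Y₁ × Y₂)) {θ ε : ℝ} (hε : 0 < ε)
    (h : ENNReal.ofReal θ ≤ ⨅ q ∈ L₂ Q, relEntropy q Qbar) :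
    ∃ δ : ℝ, 0 < δ ∧ ∃ C : ℝ, 0 < C ∧ ∀ n : ℕ, 0 < n →
      blockProb Qbar n {τ | TypUX Q δ (fun t => (τ t).1) (fun t => (τ t).2.2) ∧
        TypVYU Q δ (fun t => (τ t).1) (fun t => (τ t).2.1) (fun t => (τ t).2.2) ∧
        TypUVY Q δ (fun t => (τ t).1) (fun t => (τ t).2.1) (fun t => (τ t).2.2)} ≤
      C * Real.exp (-(n * (θ - ε))) := by
  let L : (U × X) ⊕ (V × Y₁ × U) ⊕ (U × V × Y₂) → (U × V × X × Y₁ × Y₂ → ℝ) → ℝ := Sum.elim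
    (fun k q => marg (fun a => (cU a, cX a)) q k) (Sum.elim
    (fun k q => marg (fun a => (cV a, cY₁ a, cU a)) q k)
    (fun k q => marg (fun a => (cU a, cV a, cY₂ a)) q k))
  let m : (U × X) ⊕ (V × Y₁ × U) ⊕ (U × V × Y₂) → ℝ := Sum.elim
    (fun k => pr (Q.map fun ω => (cU ω, cX ω)) k) (Sum.elim
    (fun k => pr (Q.map fun ω => (cV ω, cY₁ ω, cU ω)) k)
    (fun k => pr (Q.map fun ω => (cU ω, cV ω, cY₂ ω)) k))
  have hL : ∀ i, Continuous (L i) := by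
    rintro (k | k | k) <;> exact continuous_marg _ _
  obtain ⟨δ, hδ, C, hC, hb⟩ := exists_blockProb_near_le Qbar L hL m hε (θ := θ) (by
      intro q hq
      have hVYU : q.map (fun ω => (cV ω, cY₁ ω, cU ω)) = Q.map fun ω => (cV ω, cY₁ ω, cU ω) :=
        pmf_ext_of_pr fun k => by rw [← marg_pr]; exact hq (Sum.inr (Sum.inl k))
      refine h.trans (iInf₂_le q ⟨?_, ?_, ?_⟩)
      · refine pmf_ext_of_pr fun k => ?_
        rw [← marg_pr]; exact hq (Sum.inl k)
      · have := congrArg (PMF.map fun k : V × Y₁ × U => (k.2.2, k.1, k.2.1)) hVYU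
        rwa [pr_map_map, pr_map_map] at this
      · refine pmf_ext_of_pr fun k => ?_
        rw [← marg_pr]; exact hq (Sum.inr (Sum.inr k)))
  refine ⟨δ, hδ, C, hC, fun n hn => (blockProb_mono _ _ ?_).trans (hb n hn)⟩
  rintro τ ⟨h1, h2, h3⟩ (k | k | k)
  · have he := marg_emp τ (fun ω => (cU ω, cX ω)) k
    simp only [L, m, Sum.elim_inl]
    rw [he]
    exact h1.1 k
  · have he := marg_emp τ (fun ω => (cV ω, cY₁ ω, cU ω)) k
    simp only [L, m, Sum.elim_inl, Sum.elim_inr]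
    rw [he]
    exact h2.1 k
  · have he := marg_emp τ (fun ω => (cU ω, cV ω, cY₂ ω)) k
    simp only [L, m, Sum.elim_inr]
    rw [he]
    exact h3.1 k

end Exponents

/-! ### The code of a codebook -/

section CodeConstruction

open scoped Classical

/-- The code built from a two-layer codebook `(c, e)` and joint tests `T₁`, `T₂`, `T₃`. The sensor
sends the index of a word that passes `T₁` with its block, Detector 1 that of a second-layer word
that passes `T₂`; one more message reports a failure. Detector 1 accepts if both searches succeed,
Detector 2 if moreover the two words pass `T₃`. -/
lemma exists_code_of_codebook {X Y₁ Y₂ 𝒰 𝒱 : Type*} {n M₁ M₂ : ℕ} (c : Fin M₁ → 𝒰)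
    (e : Fin M₂ × 𝒰 → 𝒱) (T₁ : 𝒰 → (Fin n → X) → Prop) (T₂ : 𝒰 → 𝒱 → (Fin n → Y₁) → Prop)
    (T₃ : 𝒰 → 𝒱 → (Fin n → Y₂) → Prop) :
    ∃ k : Code X Y₁ Y₂ n, k.W₁ = M₁ + 1 ∧ k.W₂ = M₂ + 1 ∧ ∀ (s : Fin n → X × Y₁ × Y₂) (x y z),
      x = (fun t => (s t).1) → y = (fun t => (s t).2.1) → z = (fun t => (s t).2.2) →
      (k.guess₁ s = 1 ∨ k.guess₂ s = 1 → (∀ i, ¬ T₁ (c i) x) ∨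
        (∃ i, T₁ (c i) x ∧ ∀ j, ¬ T₂ (c i) (e (j, c i)) y) ∨
        ∃ i j, T₁ (c i) x ∧ T₂ (c i) (e (j, c i)) y ∧ ¬ T₃ (c i) (e (j, c i)) z) ∧
      (k.guess₁ s = 0 → ∃ i, T₁ (c i) x ∧ ∃ v, T₂ (c i) v y) ∧
      (k.guess₂ s = 0 →
        ∃ i j, T₁ (c i) x ∧ T₂ (c i) (e (j, c i)) y ∧ T₃ (c i) (e (j, c i)) z) := by
  let enc₁ : (Fin n → X) → Option (Fin M₁) := fun x =>
    if h : ∃ i, T₁ (c i) x then some h.choose else none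
  let enc₂ : Option (Fin M₁) → (Fin n → Y₁) → Option (Fin M₂) := fun m y =>
    m.bind fun i => if h : ∃ j, T₂ (c i) (e (j, c i)) y then some h.choose else none
  let f₁ := finSuccEquiv M₁
  let f₂ := finSuccEquiv M₂
  refine ⟨{
    W₁ := M₁ + 1
    W₂ := M₂ + 1
    φ₁ := fun x => f₁.symm (enc₁ x)
    φ₂ := fun m y => f₂.symm (enc₂ (f₁ m) y)
    ψ₁ := fun m y => if (enc₂ (f₁ m) y).isSome then 0 else 1
    ψ₂ := fun m m' z => if ∃ i j, f₁ m = some i ∧ f₂ m' = some j ∧ T₃ (c i) (e (j, c i)) z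
      then 0 else 1 }, rfl, rfl, ?_⟩
  rintro s x y z rfl rfl rfl
  simp only [Code.guess₁, Code.guess₂, Equiv.apply_symm_apply]
  set x := fun t => (s t).1
  set y := fun t => (s t).2.1
  set z := fun t => (s t).2.2
  have h10 : (1 : Fin 2) ≠ 0 := by decide
  by_cases h1 : ∃ i, T₁ (c i) x
  swap
  · have e1 : enc₁ x = none := dif_neg h1
    push Not at h1
    simp [e1, enc₂, h1]
  obtain ⟨i, e1, hi⟩ : ∃ i, enc₁ x = some i ∧ T₁ (c i) x :=
    ⟨h1.choose, dif_pos h1, h1.choose_spec⟩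
  by_cases h2 : ∃ j, T₂ (c i) (e (j, c i)) y
  swap
  · have e2 : enc₂ (some i) y = none := by simp only [enc₂, Option.bind_some, dif_neg h2]
    push Not at h2
    simp only [e1, e2]
    refine ⟨fun _ => Or.inr (Or.inl ⟨i, hi, h2⟩), ?_, ?_⟩ <;> simp
  obtain ⟨j, e2, hj⟩ : ∃ j, enc₂ (some i) y = some j ∧ T₂ (c i) (e (j, c i)) y :=
    ⟨h2.choose, by simp only [enc₂, Option.bind_some, dif_pos h2], h2.choose_spec⟩
  simp only [e1, e2, Option.isSome_some, if_true]
  refine ⟨?_, fun _ => ⟨i, hi, _, hj⟩, ?_⟩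
  · rintro (h | h)
    · exact absurd h.symm h10
    · refine Or.inr (Or.inr ⟨i, j, hi, hj, fun h3 => ?_⟩)
      rw [if_pos ⟨i, j, rfl, rfl, h3⟩] at h
      exact h10 h.symm
  · intro h
    by_cases h3 : T₃ (c i) (e (j, c i)) z
    · exact ⟨i, j, hi, hj, h3⟩
    · rw [if_neg] at h
      · exact absurd h h10
      · rintro ⟨i', j', hi', hj', h'⟩
        obtain rfl := Option.some.inj hi'
        obtain rfl := Option.some.inj hj'
        exact h3 h'

end CodeConstruction

/-! ### Codebook sizes -/

section Sizes

lemma natCeil_exp_le {x : ℝ} (hx : 0 ≤ x) : (⌈Real.exp x⌉₊ : ℝ) ≤ 2 * Real.exp x := by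
  have h1 := Nat.ceil_lt_add_one (Real.exp_pos x).le
  have h2 := Real.one_le_exp hx
  linarith

/-- A codebook of size `exp (n (I + 2 η))` makes the union bound lose only `exp (3 n η)`. -/
lemma natCeil_exp_mul_le {I η : ℝ} (hI : 0 ≤ I) (hη : 0 ≤ η) (n : ℕ) :
    (⌈Real.exp (n * (I + 2 * η))⌉₊ : ℝ) * Real.exp (-(n * (I - η))) ≤
      2 * Real.exp (n * (3 * η)) := by
  have := natCeil_exp_le (x := n * (I + 2 * η)) (by positivity)
  refine (mul_le_mul_of_nonneg_right this (Real.exp_pos _).le).trans (le_of_eq ?_)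
  rw [mul_assoc, ← Real.exp_add]
  congr 2; ring

/-- A codebook of size `exp (n (I + 2 η))` misses a target of probability `exp (-n (I + η))` with
doubly exponentially small probability. -/
lemma exp_neg_natCeil_mul_le {I η : ℝ} (n : ℕ) :
    Real.exp (-((⌈Real.exp (n * (I + 2 * η))⌉₊ : ℝ) * Real.exp (-(n * (I + η))))) ≤
      Real.exp (-(n * η)) := by
  rw [Real.exp_le_exp, neg_le_neg_iff]
  calc n * η ≤ Real.exp (n * η) := by
        have := Real.add_one_le_exp (n * η)
        linarith
    _ = Real.exp (n * (I + 2 * η)) * Real.exp (-(n * (I + η))) := by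
        rw [← Real.exp_add]; congr 1; ring
    _ ≤ _ := mul_le_mul_of_nonneg_right (Nat.le_ceil _) (Real.exp_pos _).le

lemma tendsto_mul_exp_neg (A : ℝ) {c : ℝ} (hc : 0 < c) :
    Tendsto (fun n : ℕ => A * Real.exp (-(n * c))) atTop (𝓝 0) := by
  rw [← mul_zero A]
  refine Tendsto.const_mul A (Real.tendsto_exp_neg_atTop_nhds_zero.comp ?_)
  exact tendsto_natCast_atTop_atTop.atTop_mul_const hc

end Sizes

/-! ### Good codes at a fixed blocklength -/

section Achievability

open scoped Classical

variable {X Y₁ Y₂ : Type*} [Fintype X] [Fintype Y₁] [Fintype Y₂]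

/-- A code of blocklength `n` whose performance is within `ε` of the exponents `θ₁`, `θ₂` and the
rates `R₁`, `R₂`. -/
def IsGoodCode (P Pbar : PMF (X × Y₁ × Y₂)) (R₁ R₂ θ₁ θ₂ ε : ℝ) {n : ℕ} (k : Code X Y₁ Y₂ n) :
    Prop :=
  k.prob₁ P Pbar 1 0 ≤ ENNReal.ofReal ε ∧ k.prob₂ P Pbar 1 0 ≤ ENNReal.ofReal ε ∧
  k.prob₁ P Pbar 0 1 ≤ ENNReal.ofReal (Real.exp (-(n * (θ₁ - ε)))) ∧
  k.prob₂ P Pbar 0 1 ≤ ENNReal.ofReal (Real.exp (-(n * (θ₂ - ε)))) ∧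
  Real.log k.W₁ ≤ n * (R₁ + ε) ∧ Real.log k.W₂ ≤ n * (R₂ + ε)

variable {U V : Type*} [Fintype U] [Fintype V]

/-- The random-coding bound evaluated: if the weighted averages of the error probabilities, bounded
by explicit exponentials, add up to less than one, then some codebook gives a code whose errors are
all small. -/
lemma exists_code_of_sum_lt_one {P Pbar : PMF (X × Y₁ × Y₂)}
    {Q Qbar : PMF (U × V × X × Y₁ × Y₂)} (hQ : IsAuxiliaryLaw P Q)
    (hQbar : IsAlternativeLaw Pbar Q Qbar) {n : ℕ} (hn : 0 < n)
    {δ₁ δ₂ δ₃ δ η₁ η₂ θ₁ θ₂ ε C₁ C₂ : ℝ}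
    (hδ₁ : 0 < δ₁) (hδ₂ : 0 < δ₂) (hδ₃ : 0 < δ₃) (hδ₁' : δ₁ ≤ 1) (hδ₂' : δ₂ ≤ 1) (hδ₃' : δ₃ ≤ 1)
    (h1 : δ₁ ≤ δ) (h2 : δ₂ ≤ δ) (h3 : δ₃ ≤ δ) (hε : 0 < ε) (hη₁ : 0 ≤ η₁) (hη₂ : 0 ≤ η₂)
    (hd₁ : δ₁ * ∑ k, |infoUX Q k| ≤ η₁) (hd₂ : δ₂ * ∑ k, |infoVY Q k| ≤ η₂)
    (hC₁ : blockProb (lawUS Qbar) n {τ | TypUX Q δ (fun t => (τ t).1) (fun t => (τ t).2) ∧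
        ∃ v, TypVYU Q δ (fun t => (τ t).1) v (fun t => (τ t).2)} ≤
      C₁ * Real.exp (-(n * (θ₁ - ε / 2))))
    (hC₂ : blockProb Qbar n {τ | TypUX Q δ (fun t => (τ t).1) (fun t => (τ t).2.2) ∧
        TypVYU Q δ (fun t => (τ t).1) (fun t => (τ t).2.1) (fun t => (τ t).2.2) ∧
        TypUVY Q δ (fun t => (τ t).1) (fun t => (τ t).2.1) (fun t => (τ t).2.2)} ≤
      C₂ * Real.exp (-(n * (θ₂ - ε / 2))))
    (hsum : 1 / ε * (2 * Fintype.card (U × X)) * Real.exp (-(n * (δ₁ ^ 2 / 4))) +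
      1 / ε * Real.exp (-(n * η₁)) +
      1 / ε * 2 * (2 * Fintype.card (V × Y₁ × U)) * Real.exp (-(n * (δ₂ ^ 2 / 4 - 3 * η₁))) +
      1 / ε * 2 * Real.exp (-(n * (η₂ - 3 * η₁))) +
      1 / ε * 4 * (2 * Fintype.card (U × V × Y₂)) *
        Real.exp (-(n * (δ₃ ^ 2 / 4 - 3 * η₁ - 3 * η₂))) +
      2 * C₁ * Real.exp (-(n * (ε / 2 - 3 * η₁))) +
      4 * C₂ * Real.exp (-(n * (ε / 2 - 3 * η₁ - 3 * η₂))) < 1) :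
    ∃ k : Code X Y₁ Y₂ n,
      k.W₁ = ⌈Real.exp (n * (mutualInfo Q cU cX + 2 * η₁))⌉₊ + 1 ∧
      k.W₂ = ⌈Real.exp (n * (condMutualInfo Q cV cY₁ cU + 2 * η₂))⌉₊ + 1 ∧
      k.prob₁ P Pbar 1 0 ≤ ENNReal.ofReal ε ∧ k.prob₂ P Pbar 1 0 ≤ ENNReal.ofReal ε ∧
      k.prob₁ P Pbar 0 1 ≤ ENNReal.ofReal (Real.exp (-(n * (θ₁ - ε)))) ∧
      k.prob₂ P Pbar 0 1 ≤ ENNReal.ofReal (Real.exp (-(n * (θ₂ - ε)))) := by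
  set I₁ := mutualInfo Q cU cX with hI₁
  set I₂ := condMutualInfo Q cV cY₁ cU with hI₂
  have hI₁0 : 0 ≤ I₁ := mutualInfo_nonneg Q
  have hI₂0 : 0 ≤ I₂ := condMutualInfo_nonneg Q
  set M₁ := ⌈Real.exp (n * (I₁ + 2 * η₁))⌉₊ with hM₁
  set M₂ := ⌈Real.exp (n * (I₂ + 2 * η₂))⌉₊ with hM₂
  have m1 := natCeil_exp_mul_le hI₁0 hη₁ n
  have m2 := natCeil_exp_mul_le hI₂0 hη₂ n
  have m1' := exp_neg_natCeil_mul_le (I := I₁) (η := η₁) n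
  have m2' := exp_neg_natCeil_mul_le (I := I₂) (η := η₂) n
  rw [← hM₁] at m1 m1'
  rw [← hM₂] at m2 m2'
  -- atypical blocks under the null hypothesis
  have t1 : blockProb (lawUS Q) n
      {τ | ¬ TypUX Q δ₁ (fun t => (τ t).1) (fun t => (τ t).2)} ≤
      (2 * Fintype.card (U × X)) * Real.exp (-(n * (δ₁ ^ 2 / 4))) := by
    have := blockProb_not_typ_le (lawUS Q) (fun k => (k.1, k.2.1)) hδ₁ hδ₁' n hn
    rw [lawUS, pr_map_map] at this
    exact this
  have t2 : blockProb Q n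
      {τ | ¬ TypVYU Q δ₂ (fun t => (τ t).1) (fun t => (τ t).2.1) (fun t => (τ t).2.2)} ≤
      (2 * Fintype.card (V × Y₁ × U)) * Real.exp (-(n * (δ₂ ^ 2 / 4))) :=
    blockProb_not_typ_le Q (fun ω => (cV ω, cY₁ ω, cU ω)) hδ₂ hδ₂' n hn
  have t3 : blockProb Q n
      {τ | ¬ TypUVY Q δ₃ (fun t => (τ t).1) (fun t => (τ t).2.1) (fun t => (τ t).2.2)} ≤
      (2 * Fintype.card (U × V × Y₂)) * Real.exp (-(n * (δ₃ ^ 2 / 4))) :=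
    blockProb_not_typ_le Q (fun ω => (cU ω, cV ω, cY₂ ω)) hδ₃ hδ₃' n hn
  have hexp3 : ∀ a b c : ℝ, Real.exp (n * a) * (Real.exp (n * b) * Real.exp (-(n * c))) =
      Real.exp (-(n * (c - a - b))) := fun a b c => by
    rw [← Real.exp_add, ← Real.exp_add]; congr 1; ring
  have hexp2 : ∀ a c : ℝ, Real.exp (n * a) * Real.exp (-(n * c)) =
      Real.exp (-(n * (c - a))) := fun a c => by
    rw [← Real.exp_add]; congr 1; ring
  -- the five averages
  have b1 := (first_layer_covering (n := n) hQ hd₁ M₁).trans (add_le_add t1 m1')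
  have b2 : M₁ * ∑ s : Fin n → X × Y₁ × Y₂, blockPr P s * ∑ u, blockPr (Q.map cU) u *
      (ind (TypUX Q δ₁ u s) * (∑ v, kernelBlock Q u v * ind (¬ TypVYU Q δ₂ u v s)) ^ M₂) ≤
      2 * (2 * Fintype.card (V × Y₁ × U)) * Real.exp (-(n * (δ₂ ^ 2 / 4 - 3 * η₁))) +
      2 * Real.exp (-(n * (η₂ - 3 * η₁))) := by
    have := (second_layer_covering (n := n) hQ hd₁ hd₂ M₂).trans
      (mul_le_mul_of_nonneg_left (add_le_add t2 m2') (Real.exp_pos _).le)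
    refine (mul_le_mul_of_nonneg_left this (Nat.cast_nonneg _)).trans ?_
    rw [← mul_assoc]
    refine (mul_le_mul_of_nonneg_right m1 (by positivity)).trans (le_of_eq ?_)
    rw [← hexp2, ← hexp2]
    ring
  -- the union bound over all pairs of words
  have hpair : ∀ {x y b : ℝ}, x ≤ Real.exp (-(n * (I₁ - η₁))) *
      (Real.exp (-(n * (I₂ - η₂))) * y) → y ≤ b → 0 ≤ b → M₁ * M₂ * x ≤
      4 * (Real.exp (n * (3 * η₁)) * (Real.exp (n * (3 * η₂)) * b)) := by
    intro x y b hx hy hb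
    calc M₁ * M₂ * x ≤ M₁ * M₂ * (Real.exp (-(n * (I₁ - η₁))) *
          (Real.exp (-(n * (I₂ - η₂))) * b)) := by gcongr; exact hx.trans (by gcongr)
      _ = (M₁ * Real.exp (-(n * (I₁ - η₁)))) * ((M₂ * Real.exp (-(n * (I₂ - η₂)))) * b) := by
          ring
      _ ≤ (2 * Real.exp (n * (3 * η₁))) * ((2 * Real.exp (n * (3 * η₂))) * b) := by gcongr
      _ = _ := by ring
  have b3 : M₁ * M₂ * ∑ s : Fin n → X × Y₁ × Y₂, blockPr P s * ∑ u, blockPr (Q.map cU) u *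
      ∑ v, kernelBlock Q u v * ind (TypUX Q δ₁ u s ∧ TypVYU Q δ₂ u v s ∧ ¬ TypUVY Q δ₃ u v s) ≤
      4 * (2 * Fintype.card (U × V × Y₂)) *
        Real.exp (-(n * (δ₃ ^ 2 / 4 - 3 * η₁ - 3 * η₂))) := by
    have := hpair (sum_second_layer_le hQ (SameConditional.refl Q _ _) (SameConditional.refl Q _ _)
      hd₁ hd₂ (fun (u : Fin n → U) v s => TypUX Q δ₁ u s ∧ TypVYU Q δ₂ u v s ∧ ¬ TypUVY Q δ₃ u v s)
      (fun u v s h => ⟨h.1, h.2.1⟩)) ((blockProb_mono _ _ fun τ h => h.2.2).trans t3)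
      (by positivity)
    refine this.trans (le_of_eq ?_)
    rw [← hexp3]; ring
  have hC₁0 : 0 ≤ C₁ * Real.exp (-(n * (θ₁ - ε / 2))) := (blockProb_nonneg _ _ _).trans hC₁
  have hC₂0 : 0 ≤ C₂ * Real.exp (-(n * (θ₂ - ε / 2))) := (blockProb_nonneg _ _ _).trans hC₂
  have t4 : blockProb (lawUS Qbar) n {τ | TypUX Q δ₁ (fun t => (τ t).1) (fun t => (τ t).2) ∧
      ∃ v, TypVYU Q δ₂ (fun t => (τ t).1) v (fun t => (τ t).2)} ≤
      C₁ * Real.exp (-(n * (θ₁ - ε / 2))) :=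
    (blockProb_mono _ _ (by
      rintro τ ⟨hu, v, hv⟩
      exact ⟨hu.mono h1, v, hv.mono h2⟩)).trans hC₁
  have t5 : blockProb Qbar n {τ | TypUX Q δ₁ (fun t => (τ t).1) (fun t => (τ t).2.2) ∧
      TypVYU Q δ₂ (fun t => (τ t).1) (fun t => (τ t).2.1) (fun t => (τ t).2.2) ∧
      TypUVY Q δ₃ (fun t => (τ t).1) (fun t => (τ t).2.1) (fun t => (τ t).2.2)} ≤
      C₂ * Real.exp (-(n * (θ₂ - ε / 2))) :=
    (blockProb_mono _ _ (by
      rintro τ ⟨hu, hv, hw⟩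
      exact ⟨hu.mono h1, hv.mono h2, hw.mono h3⟩)).trans hC₂
  have b4 : M₁ * ∑ s : Fin n → X × Y₁ × Y₂, blockPr Pbar s * ∑ u, blockPr (Q.map cU) u *
      ind (TypUX Q δ₁ u s ∧ ∃ v, TypVYU Q δ₂ u v s) ≤
      2 * (Real.exp (n * (3 * η₁)) * (C₁ * Real.exp (-(n * (θ₁ - ε / 2))))) := by
    have := (sum_first_layer_le hQbar.1 hQbar.2.1 hd₁
      (fun (u : Fin n → U) s => TypUX Q δ₁ u s ∧ ∃ v, TypVYU Q δ₂ u v s) (fun u s h => h.1)).trans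
      (mul_le_mul_of_nonneg_left t4 (Real.exp_pos _).le)
    refine (mul_le_mul_of_nonneg_left this (Nat.cast_nonneg _)).trans ?_
    rw [← mul_assoc]
    refine (mul_le_mul_of_nonneg_right m1 hC₁0).trans (le_of_eq (by ring))
  have b5 : M₁ * M₂ * ∑ s : Fin n → X × Y₁ × Y₂, blockPr Pbar s * ∑ u, blockPr (Q.map cU) u *
      ∑ v, kernelBlock Q u v * ind (TypUX Q δ₁ u s ∧ TypVYU Q δ₂ u v s ∧ TypUVY Q δ₃ u v s) ≤
      4 * (Real.exp (n * (3 * η₁)) * (Real.exp (n * (3 * η₂)) *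
        (C₂ * Real.exp (-(n * (θ₂ - ε / 2)))))) :=
    hpair (sum_second_layer_le hQbar.1 hQbar.2.1 hQbar.2.2
      hd₁ hd₂ (fun (u : Fin n → U) v s => TypUX Q δ₁ u s ∧ TypVYU Q δ₂ u v s ∧ TypUVY Q δ₃ u v s)
      (fun u v s h => ⟨h.1, h.2.1⟩)) t5 hC₂0
  obtain ⟨c, e, hce⟩ := exists_codebook (fun u => blockPr_nonneg (Q.map cU) u)
    (sum_blockPr (Q.map cU) n) (fun u v => kernelBlock_nonneg (Q := Q) u v)
    (fun u => sum_kernelBlock u) (fun s => blockPr_nonneg P s) (fun s => blockPr_nonneg Pbar s)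
    M₁ M₂ (fun u s => TypUX Q δ₁ u s) (fun u s => TypUX Q δ₁ u s ∧ ∃ v, TypVYU Q δ₂ u v s)
    (fun u v s => TypVYU Q δ₂ u v s) (fun u v s => TypUVY Q δ₃ u v s)
    (l₀ := 1 / ε) (l₁ := Real.exp (n * (θ₁ - ε))) (l₂ := Real.exp (n * (θ₂ - ε)))
    (by positivity) (Real.exp_pos _).le (Real.exp_pos _).le (by
      refine lt_of_le_of_lt ?_ hsum
      refine (add_le_add (add_le_add
        (mul_le_mul_of_nonneg_left (add_le_add (add_le_add b1 b2) b3) (by positivity))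
        (mul_le_mul_of_nonneg_left b4 (Real.exp_pos _).le))
        (mul_le_mul_of_nonneg_left b5 (Real.exp_pos _).le)).trans (le_of_eq ?_)
      have e4 : Real.exp (-(n * (ε / 2 - 3 * η₁))) = Real.exp (n * (θ₁ - ε)) *
          (Real.exp (n * (3 * η₁)) * Real.exp (-(n * (θ₁ - ε / 2)))) := by
        rw [hexp3]; congr 1; ring
      have e5 : Real.exp (-(n * (ε / 2 - 3 * η₁ - 3 * η₂))) = Real.exp (n * (θ₂ - ε)) *
          (Real.exp (n * (3 * η₁)) * (Real.exp (n * (3 * η₂)) *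
            Real.exp (-(n * (θ₂ - ε / 2))))) := by
        rw [hexp3, ← Real.exp_add]; congr 1; ring
      rw [e4, e5]
      ring)
  obtain ⟨k, hW₁, hW₂, hk⟩ := exists_code_of_codebook c e
    (fun u (x : Fin n → X) => Typ (Q.map fun ω => (cU ω, cX ω)) δ₁ fun t => (u t, x t))
    (fun u v (y : Fin n → Y₁) =>
      Typ (Q.map fun ω => (cV ω, cY₁ ω, cU ω)) δ₂ fun t => (v t, y t, u t))
    (fun u v (z : Fin n → Y₂) =>
      Typ (Q.map fun ω => (cU ω, cV ω, cY₂ ω)) δ₃ fun t => (u t, v t, z t))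
  replace hk := fun s => hk s _ _ _ rfl rfl rfl
  have hprob : ∀ (p : PMF (X × Y₁ × Y₂)) (A : Set (Fin n → X × Y₁ × Y₂))
      (B : (Fin n → X × Y₁ × Y₂) → Prop) (b : ℝ), (∀ s ∈ A, B s) →
      ∑ s : Fin n → X × Y₁ × Y₂, blockPr p s * ind (B s) ≤ b → iidProb p n A ≤ ENNReal.ofReal b := by
    intro p A B b hAB hb
    rw [iidProb_eq_ofReal, blockProb_eq_sum_ind]
    refine ENNReal.ofReal_le_ofReal (le_trans ?_ hb)
    exact Finset.sum_le_sum fun s _ =>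
      mul_le_mul_of_nonneg_left (ind_mono (hAB s)) (blockPr_nonneg _ _)
  have hnn : ∀ (p : PMF (X × Y₁ × Y₂)) (B : (Fin n → X × Y₁ × Y₂) → Prop),
      0 ≤ ∑ s : Fin n → X × Y₁ × Y₂, blockPr p s * ind (B s) := fun p B =>
    Finset.sum_nonneg fun s _ => mul_nonneg (blockPr_nonneg _ _) (ind_nonneg _)
  -- each of the three summands is nonnegative, hence less than one
  have hα := lt_of_le_of_lt (le_add_of_nonneg_right (mul_nonneg (Real.exp_pos _).le (hnn _ _)))
    (lt_of_le_of_lt (le_add_of_nonneg_right (mul_nonneg (Real.exp_pos _).le (hnn _ _))) hce)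
  have hβ₁ := lt_of_le_of_lt (le_add_of_nonneg_left
    (mul_nonneg (one_div_pos.mpr hε).le (hnn _ _)))
    (lt_of_le_of_lt (le_add_of_nonneg_right (mul_nonneg (Real.exp_pos _).le (hnn _ _))) hce)
  have hβ₂ := lt_of_le_of_lt (le_add_of_nonneg_left
    (add_nonneg (mul_nonneg (one_div_pos.mpr hε).le (hnn _ _))
      (mul_nonneg (Real.exp_pos _).le (hnn _ _)))) hce
  have hinv : ∀ {x y : ℝ}, Real.exp y * x < 1 → x ≤ Real.exp (-y) := by
    intro x y h
    rw [Real.exp_neg, ← one_div, le_div_iff₀ (Real.exp_pos y)]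
    linarith
  have hα' := (mul_lt_iff_lt_one_right hε).mpr hα
  rw [← mul_assoc, mul_one_div_cancel hε.ne', one_mul] at hα'
  refine ⟨k, hW₁, hW₂, ?_, ?_, ?_, ?_⟩
  · exact hprob P _ _ _ (fun s hs => (hk s).1 (Or.inl hs)) hα'.le
  · exact hprob P _ _ _ (fun s hs => (hk s).1 (Or.inr hs)) hα'.le
  · exact hprob Pbar _ _ _ (fun s hs => (hk s).2.1 hs) (hinv hβ₁)
  · exact hprob Pbar _ _ _ (fun s hs => (hk s).2.2 hs) (hinv hβ₂)

end Achievability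

/-! ### Asymptotics -/

section Limits

open scoped Classical

variable {X Y₁ Y₂ : Type*} [Fintype X] [Fintype Y₁] [Fintype Y₂]

lemma log_natCeil_exp_add_one_le {x : ℝ} (hx : 0 ≤ x) :
    Real.log ((⌈Real.exp x⌉₊ + 1 : ℕ) : ℝ) ≤ Real.log 3 + x := by
  have h1 := natCeil_exp_le hx
  have h2 := Real.one_le_exp hx
  rw [← Real.log_exp x, ← Real.log_mul (by norm_num) (Real.exp_pos _).ne', Real.log_exp]
  refine Real.log_le_log (by positivity) ?_
  push_cast
  linarith

/-- Good codes exist at every sufficiently large blocklength. The typicality constants are chosen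
from the last test to the first: the exponent `δ₃ ^ 2 / 4` of atypicality in the last test has to
beat the loss `3 * η₂ + 3 * η₁` of the two union bounds, and `δ₂ ^ 2 / 4` and `η₂` the loss
`3 * η₁` of the first one. -/
lemma eventually_exists_isGoodCode {U V : Type*} [Fintype U] [Fintype V]
    {P Pbar : PMF (X × Y₁ × Y₂)} {R₁ R₂ : ℝ} {Q Qbar : PMF (U × V × X × Y₁ × Y₂)}
    (hQ : Q ∈ auxiliarySet P R₁ R₂) (hQbar : IsAlternativeLaw Pbar Q Qbar) {θ₁ θ₂ : ℝ}
    (h₁ : ENNReal.ofReal θ₁ ≤ ⨅ q ∈ L₁ Q,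
      relEntropy q (Qbar.map fun ω => (cU ω, cX ω, cY₁ ω)))
    (h₂ : ENNReal.ofReal θ₂ ≤ ⨅ q ∈ L₂ Q, relEntropy q Qbar) {ε : ℝ} (hε : 0 < ε) :
    ∀ᶠ n : ℕ in atTop, ∃ k : Code X Y₁ Y₂ n, IsGoodCode P Pbar R₁ R₂ θ₁ θ₂ ε k := by
  obtain ⟨d₁, hd₁, C₁, hC₁, hb₁⟩ := exists_exponent_detector₁ Q Qbar (half_pos hε) h₁
  obtain ⟨d₂, hd₂, C₂, hC₂, hb₂⟩ := exists_exponent_detector₂ Q Qbar (half_pos hε) h₂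
  set δ := min (min d₁ d₂) 1 with hδ
  have hδ0 : 0 < δ := by positivity
  have hδ1 : δ ≤ 1 := min_le_right _ _
  set K₁ := ∑ k, |infoUX Q k| with hK₁
  set K₂ := ∑ k, |infoVY Q k| with hK₂
  have hK₁0 : 0 ≤ K₁ := Finset.sum_nonneg fun _ _ => abs_nonneg _
  have hK₂0 : 0 ≤ K₂ := Finset.sum_nonneg fun _ _ => abs_nonneg _
  set η₂ := min (δ ^ 2 / 4) ε / 16 with hη₂
  have hη₂0 : 0 < η₂ := by positivity
  set δ₂ := min δ (η₂ / (K₂ + 1)) with hδ₂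
  have hδ₂0 : 0 < δ₂ := by positivity
  set η₁ := min (δ₂ ^ 2 / 4) η₂ / 16 with hη₁
  have hη₁0 : 0 < η₁ := by positivity
  set δ₁ := min δ (η₁ / (K₁ + 1)) with hδ₁
  have hδ₁0 : 0 < δ₁ := by positivity
  have hprod : ∀ {d η K : ℝ}, 0 ≤ K → 0 ≤ η → d ≤ η / (K + 1) → d * K ≤ η := by
    intro d η K hK hη hd
    rw [le_div_iff₀ (by positivity)] at hd
    rcases le_total 0 d with h | h <;> nlinarith
  have e1 : η₂ ≤ δ ^ 2 / 4 / 16 := div_le_div_of_nonneg_right (min_le_left _ _) (by norm_num)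
  have e2 : η₂ ≤ ε / 16 := div_le_div_of_nonneg_right (min_le_right _ _) (by norm_num)
  have e3 : η₁ ≤ δ₂ ^ 2 / 4 / 16 := div_le_div_of_nonneg_right (min_le_left _ _) (by norm_num)
  have e4 : η₁ ≤ η₂ / 16 := div_le_div_of_nonneg_right (min_le_right _ _) (by norm_num)
  have hδsq : 0 < δ ^ 2 := by positivity
  have hδ₂sq : 0 < δ₂ ^ 2 := by positivity
  have htend := ((((((tendsto_mul_exp_neg (1 / ε * (2 * Fintype.card (U × X)))
    (c := δ₁ ^ 2 / 4) (by positivity)).add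
    (tendsto_mul_exp_neg (1 / ε) hη₁0)).add
    (tendsto_mul_exp_neg (1 / ε * 2 * (2 * Fintype.card (V × Y₁ × U)))
      (c := δ₂ ^ 2 / 4 - 3 * η₁) (by linarith))).add
    (tendsto_mul_exp_neg (1 / ε * 2) (c := η₂ - 3 * η₁) (by linarith))).add
    (tendsto_mul_exp_neg (1 / ε * 4 * (2 * Fintype.card (U × V × Y₂)))
      (c := δ ^ 2 / 4 - 3 * η₁ - 3 * η₂) (by linarith))).add
    (tendsto_mul_exp_neg (2 * C₁) (c := ε / 2 - 3 * η₁) (by linarith))).add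
    (tendsto_mul_exp_neg (4 * C₂) (c := ε / 2 - 3 * η₁ - 3 * η₂) (by linarith))
  simp only [add_zero] at htend
  have hlog : ∀ᶠ n : ℕ in atTop, Real.log 3 ≤ n * (ε / 2) :=
    (tendsto_natCast_atTop_atTop.atTop_mul_const (half_pos hε)).eventually_ge_atTop _
  filter_upwards [htend.eventually_lt_const one_pos, hlog, eventually_gt_atTop 0]
    with n hlt hlogn hn
  obtain ⟨k, hW₁, hW₂, hk₁, hk₂, hk₃, hk₄⟩ := exists_code_of_sum_lt_one hQ.1 hQbar hn hδ₁0
    hδ₂0 hδ0 ((min_le_left _ _).trans hδ1) ((min_le_left _ _).trans hδ1) hδ1 (min_le_left _ _)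
    (min_le_left _ _) le_rfl hε hη₁0.le hη₂0.le
    (hprod hK₁0 hη₁0.le (min_le_right _ _)) (hprod hK₂0 hη₂0.le (min_le_right _ _))
    ((blockProb_mono _ _ (by
      rintro τ ⟨hu, v, hv⟩
      exact ⟨hu.mono ((min_le_left _ _).trans (min_le_left _ _)), v,
        hv.mono ((min_le_left _ _).trans (min_le_left _ _))⟩)).trans (hb₁ n hn))
    ((blockProb_mono _ _ (by
      rintro τ ⟨hu, hv, hw⟩
      exact ⟨hu.mono ((min_le_left _ _).trans (min_le_right _ _)),
        hv.mono ((min_le_left _ _).trans (min_le_right _ _)),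
        hw.mono ((min_le_left _ _).trans (min_le_right _ _))⟩)).trans (hb₂ n hn)) hlt
  have hn0 : (0 : ℝ) ≤ n := Nat.cast_nonneg n
  have hI₁ := mutualInfo_nonneg Q
  have hI₂ := condMutualInfo_nonneg Q
  refine ⟨k, hk₁, hk₂, hk₃, hk₄, ?_, ?_⟩
  · rw [hW₁]
    refine (log_natCeil_exp_add_one_le (by positivity)).trans ?_
    have : n * (mutualInfo Q cU cX + 2 * η₁ + ε / 2) ≤ n * (R₁ + ε) :=
      mul_le_mul_of_nonneg_left (by linarith [hQ.2.1]) hn0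
    linarith
  · rw [hW₂]
    refine (log_natCeil_exp_add_one_le (by positivity)).trans ?_
    have : n * (condMutualInfo Q cV cY₁ cU + 2 * η₂ + ε / 2) ≤ n * (R₂ + ε) :=
      mul_le_mul_of_nonneg_left (by linarith [hQ.2.2]) hn0
    linarith

lemma IsGoodCode.mono {P Pbar : PMF (X × Y₁ × Y₂)} {R₁ R₂ θ₁ θ₂ ε ε' : ℝ} {n : ℕ}
    {k : Code X Y₁ Y₂ n} (h : IsGoodCode P Pbar R₁ R₂ θ₁ θ₂ ε k) (hε : ε ≤ ε') :
    IsGoodCode P Pbar R₁ R₂ θ₁ θ₂ ε' k := by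
  obtain ⟨a1, a2, a3, a4, a5, a6⟩ := h
  have hn : (0 : ℝ) ≤ n := Nat.cast_nonneg n
  have hθ : ∀ θ : ℝ, ENNReal.ofReal (Real.exp (-(n * (θ - ε)))) ≤
      ENNReal.ofReal (Real.exp (-(n * (θ - ε')))) := fun θ =>
    ENNReal.ofReal_le_ofReal (Real.exp_le_exp.mpr (neg_le_neg
      (mul_le_mul_of_nonneg_left (by linarith) hn)))
  have hR : ∀ R : ℝ, n * (R + ε) ≤ n * (R + ε') := fun R =>
    mul_le_mul_of_nonneg_left (by linarith) hn
  exact ⟨a1.trans (ENNReal.ofReal_le_ofReal hε), a2.trans (ENNReal.ofReal_le_ofReal hε),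
    a3.trans (hθ _), a4.trans (hθ _), a5.trans (hR _), a6.trans (hR _)⟩

/-- Diagonalization: if for each tolerance objects exist at all large `n`, then a single
sequence eventually meets every tolerance. -/
lemma exists_seq_of_forall_eventually {C : ℕ → Type*} [∀ n, Nonempty (C n)]
    (G : ℝ → ∀ n, C n → Prop) (hG : ∀ ε ε' n k, ε ≤ ε' → G ε n k → G ε' n k)
    (h : ∀ ε > 0, ∀ᶠ n in atTop, ∃ k, G ε n k) :
    ∃ c : ∀ n, C n, ∀ ε > 0, ∀ᶠ n in atTop, G ε n (c n) := by
  -- at index `n` the best tolerance `1 / (m + 1)` with `m ≤ n` that can be met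
  let m : ℕ → ℕ := fun n => Nat.findGreatest (fun m => ∃ k, G (1 / ((m : ℝ) + 1)) n k) n
  have hc : ∀ n, ∃ k : C n, (∃ k, G (1 / ((m n : ℝ) + 1)) n k) → G (1 / ((m n : ℝ) + 1)) n k := by
    intro n
    by_cases hk : ∃ k, G (1 / ((m n : ℝ) + 1)) n k
    · exact ⟨hk.choose, fun _ => hk.choose_spec⟩
    · exact ⟨Classical.arbitrary _, fun h => absurd h hk⟩
  choose c hc using hc
  refine ⟨c, fun ε hε => ?_⟩
  obtain ⟨m₀, hm₀⟩ := exists_nat_one_div_lt hε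
  filter_upwards [h (1 / ((m₀ : ℝ) + 1)) (by positivity), eventually_ge_atTop m₀] with n hn hmn
  have hle : m₀ ≤ m n := Nat.le_findGreatest hmn hn
  have hspec : ∃ k, G (1 / ((m n : ℝ) + 1)) n k :=
    Nat.findGreatest_spec (P := fun m => ∃ k, G (1 / ((m : ℝ) + 1)) n k) hmn hn
  refine hG _ _ _ _ ?_ (hc n hspec)
  refine le_trans ?_ hm₀.le
  have : (m₀ : ℝ) ≤ m n := by exact_mod_cast hle
  exact one_div_le_one_div_of_le (by positivity) (by linarith)

lemma limsup_le_zero_of_forall {u : ℕ → ℝ≥0∞}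
    (h : ∀ ε : ℝ, 0 < ε → ∀ᶠ n in atTop, u n ≤ ENNReal.ofReal ε) : limsup u atTop ≤ 0 := by
  have : Tendsto u atTop (𝓝 0) := by
    rw [ENNReal.tendsto_nhds_zero]
    intro ε hε
    obtain ⟨r, hr, hrε⟩ := ENNReal.lt_iff_exists_nnreal_btwn.mp hε
    filter_upwards [h r (by exact_mod_cast hr)] with n hn
    rw [ENNReal.ofReal_coe_nnreal] at hn
    exact hn.trans hrε.le
  exact this.limsup_eq.le

lemma le_errorExponent {n : ℕ} (hn : 0 < n) {β : ℝ≥0∞} {x : ℝ}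
    (h : β ≤ ENNReal.ofReal (Real.exp (-(n * x)))) : (x : EReal) ≤ errorExponent n β := by
  unfold errorExponent
  rw [EReal.le_div_iff_mul_le (by exact_mod_cast hn) (EReal.natCast_ne_top n)]
  have h1 := ENNReal.log_monotone h
  rw [ENNReal.log_ofReal_of_pos (Real.exp_pos _), Real.log_exp] at h1
  have h2 := EReal.neg_le_neg_iff.mpr h1
  refine le_trans (le_of_eq ?_) h2
  rw [← EReal.coe_neg, neg_neg, mul_comm]
  rfl

lemma le_liminf_of_forall {u : ℕ → EReal} {θ : ℝ}
    (h : ∀ ε : ℝ, 0 < ε → ∀ᶠ n in atTop, ((θ - ε : ℝ) : EReal) ≤ u n) :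
    (θ : EReal) ≤ liminf u atTop := by
  refine le_of_forall_lt fun a ha => ?_
  obtain ⟨r, har, hr⟩ := EReal.lt_iff_exists_real_btwn.mp ha
  have hr' : r < θ := by exact_mod_cast hr
  refine har.trans_le (le_liminf_of_le (by isBoundedDefault) ?_)
  have := h (θ - r) (by linarith)
  rwa [sub_sub_cancel] at this

lemma limsup_le_of_forall {u : ℕ → EReal} {R : ℝ}
    (h : ∀ ε : ℝ, 0 < ε → ∀ᶠ n in atTop, u n ≤ ((R + ε : ℝ) : EReal)) :
    limsup u atTop ≤ (R : EReal) := by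
  refine le_of_forall_gt fun a ha => ?_
  obtain ⟨r, hr, har⟩ := EReal.lt_iff_exists_real_btwn.mp ha
  have hr' : R < r := by exact_mod_cast hr
  refine lt_of_le_of_lt (limsup_le_of_le (by isBoundedDefault) ?_) har
  have := h (r - R) (by linarith)
  rwa [add_sub_cancel] at this

/-- Codes within every tolerance give the exponents and the rates exactly, without passing to the
closure. -/
lemma isAchievable_of_forall_eventually {P Pbar : PMF (X × Y₁ × Y₂)} {R₁ R₂ θ₁ θ₂ : ℝ}
    (h : ∀ ε > 0, ∀ᶠ n : ℕ in atTop, ∃ k : Code X Y₁ Y₂ n,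
      IsGoodCode P Pbar R₁ R₂ θ₁ θ₂ ε k) :
    IsAchievable 1 P Pbar R₁ R₂ (θ₁, θ₂) := by
  have : ∀ n, Nonempty (Code X Y₁ Y₂ n) := fun n =>
    ⟨⟨1, 1, fun _ => 0, fun _ _ => 0, fun _ _ => 0, fun _ _ _ => 0⟩⟩
  obtain ⟨c, hc⟩ := exists_seq_of_forall_eventually
    (fun ε n (k : Code X Y₁ Y₂ n) => IsGoodCode P Pbar R₁ R₂ θ₁ θ₂ ε k)
    (fun _ _ _ _ hε hk => hk.mono hε) h
  have hrate : ∀ {n : ℕ} {x R ε : ℝ}, 0 < n → x ≤ n * (R + ε) →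
      ((x / (n : ℝ) : ℝ) : EReal) ≤ ((R + ε : ℝ) : EReal) := by
    intro n x R ε hn hx
    have hn' : (0 : ℝ) < n := by exact_mod_cast hn
    rw [EReal.coe_le_coe_iff, div_le_iff₀ hn']
    linarith
  refine ⟨c, ?_, ?_, ?_, ?_, ?_, ?_⟩
  · exact limsup_le_zero_of_forall fun ε hε => (hc ε hε).mono fun n hn => hn.1
  · exact limsup_le_zero_of_forall fun ε hε => (hc ε hε).mono fun n hn => hn.2.1
  · refine le_liminf_of_forall fun ε hε => ?_
    filter_upwards [hc ε hε, eventually_gt_atTop 0] with n hn hn0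
    exact le_errorExponent hn0 hn.2.2.1
  · refine le_liminf_of_forall fun ε hε => ?_
    filter_upwards [hc ε hε, eventually_gt_atTop 0] with n hn hn0
    exact le_errorExponent hn0 hn.2.2.2.1
  · refine limsup_le_of_forall fun ε hε => ?_
    filter_upwards [hc ε hε, eventually_gt_atTop 0] with n hn hn0
    exact hrate hn0 hn.2.2.2.2.1
  · refine limsup_le_of_forall fun ε hε => ?_
    filter_upwards [hc ε hε, eventually_gt_atTop 0] with n hn hn0
    exact hrate hn0 hn.2.2.2.2.2

end Limits

end CoopHT

end

theorem mainTheorem6 {X Y₁ Y₂ U V : Type*}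
    [Fintype X] [Fintype Y₁] [Fintype Y₂] [Fintype U] [Fintype V]
    (P Pbar : PMF (X × Y₁ × Y₂)) (R₁ R₂ : ℝ) (hR₁ : 0 ≤ R₁) (hR₂ : 0 ≤ R₂)
    (Q Qbar : PMF (U × V × X × Y₁ × Y₂))
    (hQ : Q ∈ CoopHT.auxiliarySet P R₁ R₂)
    (hQbar : CoopHT.IsAlternativeLaw Pbar Q Qbar)
    (θ₁ θ₂ : ℝ) (hθ₁ : 0 ≤ θ₁) (hθ₂ : 0 ≤ θ₂)
    (h₁ : ENNReal.ofReal θ₁ ≤ ⨅ q ∈ CoopHT.L₁ Q,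
      CoopHT.relEntropy q (Qbar.map fun ω => (CoopHT.cU ω, CoopHT.cX ω, CoopHT.cY₁ ω)))
    (h₂ : ENNReal.ofReal θ₂ ≤ ⨅ q ∈ CoopHT.L₂ Q, CoopHT.relEntropy q Qbar) :
    (θ₁, θ₂) ∈ CoopHT.exponentsRegion 1 P Pbar R₁ R₂ :=
  subset_closure (CoopHT.isAchievable_of_forall_eventually fun _ hε =>
    CoopHT.eventually_exists_isGoodCode hQ hQbar h₁ h₂ hε)
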